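/- A QUBO Hamiltonian is a polynomial $H(x_1,\dots,x_n)=\sum_{i=1}^n w_i x_i+\sum_{i=1}^n\sum_{j=i+1}^n w_{ij}x_ix_j$ with integer weights; a ground state of $H$ is a vector $x\in\{0,1\}^n$ that minimizes $H$. The terms of $H$ are the $w_ix_i$ with $w_i\neq 0$ and the $w_{ij}x_ix_j$ with $w_{ij}\neq 0$; $|H|$ is the number of variables plus the number of terms. The primal graph of $H$ has the vertices $x_1,\dots,x_n$ and connects two variables that appear together in a term, and $\mathrm{tw}(H)$ is the treewidth of this graph (taken to be $0$ if $n=0$). **Corollary (QUBO Upper Bound).** Given a QUBO Hamiltonian $H$ and a tree decomposition of its primal graph of optimal width, a ground state of $H$ can be computed in time $O\big(2^{\mathrm{tw}(H)}|H|\big)$. Precisely: there are a single random access machine program and a constant $C$ such that for every Hamiltonian $H$ and every tree decomposition of the primal graph of $H$, with $m$ nodes and width $k$ (the largest bag size minus one, or $0$ if $n=0$), the program, started on a listing of the terms of $H$ with their weights (in any order) and of the tree decomposition (rooted, every node listed after its parent with its parent and its bag), halts with a ground state of $H$ in its memory after at most $C\cdot 2^{k}\,(|H|+m)$ steps; in particular,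 if $k=\mathrm{tw}(H)$ and $m\le|H|$, after at most $C\cdot 2^{\mathrm{tw}(H)}|H|$ steps. The machine has integer registers and integer memory cells with indirect addressing, and each addition, subtraction, assignment of a constant, memory access and test for positivity takes one step; there is no multiplication, division or bit operation. -/

import Mathlib

/-! ### Hamiltonians -/

/-- A QUBO Hamiltonian `H(x_1,…,x_n) = ∑ i, w_i x_i + ∑ i, ∑ j > i, w_ij x_i x_j` with integer
weights: `lin i` is `w_i` and `quad i j`, for `i < j`, is `w_ij` (the entries of `quad` on and
below the diagonal are never used). -/
structure Hamiltonian where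
  n : ℕ
  lin : Fin n → ℤ
  quad : Fin n → Fin n → ℤ

namespace Hamiltonian

/-- The value `H(x)` at a vector `x ∈ {0,1}ⁿ`. -/
def energy (H : Hamiltonian) (x : Fin H.n → Fin 2) : ℤ :=
  ∑ i, H.lin i * ((x i : ℕ) : ℤ)
    + ∑ i, ∑ j ∈ Finset.Ioi i, H.quad i j * ((x i : ℕ) : ℤ) * ((x j : ℕ) : ℤ)

/-- `x` is a ground state: a vector in `{0,1}ⁿ` that minimizes `H`. -/
def IsGroundState (H : Hamiltonian) (x : Fin H.n → Fin 2) : Prop :=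
  ∀ y : Fin H.n → Fin 2, H.energy x ≤ H.energy y

/-- The weight of the term with variables `i ≤ j`: linear if `i = j`, quadratic if `i < j`. -/
def weight (H : Hamiltonian) (i j : Fin H.n) : ℤ :=
  if i = j then H.lin i else H.quad i j

/-- The terms of `H`: the pair `(i, i)` stands for the variable set `{x_i}` of a term
`w_i x_i` with `w_i ≠ 0`, and `(i, j)` with `i < j` for the variable set `{x_i, x_j}` of a term
`w_ij x_i x_j` with `w_ij ≠ 0`. -/
def terms (H : Hamiltonian) : Finset (Fin H.n × Fin H.n) :=
  Finset.univ.filter fun p => p.1 ≤ p.2 ∧ H.weight p.1 p.2 ≠ 0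

/-- The size `|H|`: the number of variables plus the number of (nonzero) terms. -/
def size (H : Hamiltonian) : ℕ := H.n + H.terms.card

/-- The primal graph: its vertices are the variables, and two distinct variables are adjacent
if they appear together in a term. -/
def primalGraph (H : Hamiltonian) : SimpleGraph (Fin H.n) :=
  SimpleGraph.fromRel fun i j => (i, j) ∈ H.terms

end Hamiltonian

/-! ### Treewidth -/

/-- A tree decomposition of `G`, with nodes `0, …, m - 1`. -/
structure TreeDecomposition {V : Type*} (G : SimpleGraph V) where
  m : ℕ
  tree : SimpleGraph (Fin m)
  isTree : tree.IsTree
  bag : Fin m → Finset V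
  /-- for every vertex the nodes whose bags contain it induce a nonempty subtree -/
  connected : ∀ v, (tree.induce {t | v ∈ bag t}).Connected
  /-- every edge is contained in a bag -/
  covering : ∀ u v, G.Adj u v → ∃ t, u ∈ bag t ∧ v ∈ bag t

/-- The width: the largest size of a bag, minus one (`0` if all bags are empty, which happens
only for a graph without vertices). -/
def TreeDecomposition.width {V : Type*} {G : SimpleGraph V} (D : TreeDecomposition G) : ℕ :=
  (Finset.univ.sup fun t => (D.bag t).card) - 1

/-- The treewidth: the least width of a tree decomposition. -/
noncomputable def treewidth {V : Type*} [Finite V] (G : SimpleGraph V) : ℕ :=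
  sInf (Set.range fun D : TreeDecomposition G => D.width)

/-- The treewidth `tw(H)` of a Hamiltonian is the treewidth of its primal graph. -/
noncomputable def Hamiltonian.tw (H : Hamiltonian) : ℕ := treewidth H.primalGraph

/-! ### Random access machines

A random access machine with integer registers `r_0, r_1, …` (a program mentions only finitely
many of them), a memory whose cells hold integers and are indexed by integers, addition,
subtraction, indirect addressing and tests for positivity. There is no multiplication, division
or bit operation. Every elementary instruction and every test takes one step. -/

namespace RAM

/-- A state of the machine: the contents of the registers and of the memory. -/
structure State where
  reg : ℕ → ℤ
  mem : ℤ → ℤ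

/-- Programs. -/
inductive Program where
  /-- do nothing -/
  | skip : Program
  /-- `r_d := c` -/
  | const (d : ℕ) (c : ℤ) : Program
  /-- `r_d := r_a + r_b` -/
  | add (d a b : ℕ) : Program
  /-- `r_d := r_a - r_b` -/
  | sub (d a b : ℕ) : Program
  /-- `r_d := mem[r_a]` -/
  | load (d a : ℕ) : Program
  /-- `mem[r_a] := r_b` -/
  | store (a b : ℕ) : Program
  /-- first `p`, then `q` -/
  | seq (p q : Program) : Program
  /-- if `r_a > 0` then `p` else `q` -/
  | ifPos (a : ℕ) (p q : Program) : Program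
  /-- while `r_a > 0` do `p` -/
  | whilePos (a : ℕ) (p : Program) : Program

/-- Write the value `v` to the register `r_d`. -/
def State.setReg (s : State) (d : ℕ) (v : ℤ) : State :=
  { s with reg := Function.update s.reg d v }

/-- Write the value `v` to the memory cell with address `a`. -/
def State.setMem (s : State) (a v : ℤ) : State :=
  { s with mem := Function.update s.mem a v }

/-- `Runs p s s' t`: started in state `s`, the program `p` halts in state `s'` after exactly `t`
steps. -/
inductive Runs : Program → State → State → ℕ → Prop
  | skip (s : State) : Runs .skip s s 1
  | const (s : State) (d : ℕ) (c : ℤ) : Runs (.const d c) s (s.setReg d c) 1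
  | add (s : State) (d a b : ℕ) : Runs (.add d a b) s (s.setReg d (s.reg a + s.reg b)) 1
  | sub (s : State) (d a b : ℕ) : Runs (.sub d a b) s (s.setReg d (s.reg a - s.reg b)) 1
  | load (s : State) (d a : ℕ) : Runs (.load d a) s (s.setReg d (s.mem (s.reg a))) 1
  | store (s : State) (a b : ℕ) : Runs (.store a b) s (s.setMem (s.reg a) (s.reg b)) 1
  | seq {p q : Program} {s s₁ s₂ : State} {t₁ t₂ : ℕ}
      (h₁ : Runs p s s₁ t₁) (h₂ : Runs q s₁ s₂ t₂) : Runs (.seq p q) s s₂ (t₁ + t₂)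
  | ifTrue {a : ℕ} {p q : Program} {s s' : State} {t : ℕ}
      (h : 0 < s.reg a) (hp : Runs p s s' t) : Runs (.ifPos a p q) s s' (t + 1)
  | ifFalse {a : ℕ} {p q : Program} {s s' : State} {t : ℕ}
      (h : ¬ 0 < s.reg a) (hq : Runs q s s' t) : Runs (.ifPos a p q) s s' (t + 1)
  | whileTrue {a : ℕ} {p : Program} {s s₁ s₂ : State} {t₁ t₂ : ℕ}
      (h : 0 < s.reg a) (hp : Runs p s s₁ t₁) (hw : Runs (.whilePos a p) s₁ s₂ t₂) :
      Runs (.whilePos a p) s s₂ (t₁ + t₂ + 1)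
  | whileFalse {a : ℕ} {p : Program} {s : State}
      (h : ¬ 0 < s.reg a) : Runs (.whilePos a p) s s 1

/-- The initial state on the input `l`: the entries of `l` are in the memory cells
`0, …, l.length - 1`; all other cells and all registers are zero. -/
def initial (l : List ℤ) : State where
  reg := fun _ => 0
  mem := fun a => if 0 ≤ a then l.getD a.toNat 0 else 0

end RAM

/-! ### The input -/

/-- A presentation of a Hamiltonian `H` and a tree decomposition `D` of its primal graph as a
machine input: the terms of `H` in any order, the tree rooted at node `0` with every node
numbered after its parent, and the elements of every bag in any order. -/
structure Presentation (H : Hamiltonian) (D : TreeDecomposition H.primalGraph) where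
  terms : List (Fin H.n × Fin H.n)
  terms_nodup : terms.Nodup
  mem_terms : ∀ p, p ∈ terms ↔ p ∈ H.terms
  parent : Fin D.m → Fin D.m
  parent_root : ∀ t : Fin D.m, t.val = 0 → parent t = t
  parent_lt : ∀ t : Fin D.m, 0 < t.val → parent t < t
  parent_adj : ∀ t : Fin D.m, 0 < t.val → D.tree.Adj (parent t) t
  bags : Fin D.m → List (Fin H.n)
  bags_nodup : ∀ t, (bags t).Nodup
  mem_bags : ∀ t v, v ∈ bags t ↔ v ∈ D.bag t

/-- The input as a list of integers: the number of variables; the number of terms; for each term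
its two indices and its weight; the number of nodes of the tree; for each node its parent, the
size of its bag and the elements of its bag. -/
def Presentation.encode {H : Hamiltonian} {D : TreeDecomposition H.primalGraph}
    (I : Presentation H D) : List ℤ :=
  [(H.n : ℤ), (I.terms.length : ℤ)]
    ++ I.terms.flatMap (fun p => [((p.1 : ℕ) : ℤ), ((p.2 : ℕ) : ℤ), H.weight p.1 p.2])
    ++ [(D.m : ℤ)]
    ++ (List.finRange D.m).flatMap (fun t =>
        [((I.parent t : ℕ) : ℤ), ((I.bags t).length : ℤ)]
          ++ (I.bags t).map (fun v => ((v : ℕ) : ℤ)))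

/-! The proof is dynamic programming on the rooted tree decomposition. A term is counted at the
lower of the topmost nodes of its variables. Connectedness and covering put its variables into the
bag of that node (`mem_bag_parent`, `mem_max_top`). So the energy is a sum of tables, one for each
node, with an entry for every assignment to the bag (`energy_eq_sum_tables`).

Nodes are eliminated by decreasing number, hence children before parents. The table of `t` is
written as `M + E`. Here `M` is the minimum over all assignments to the bag with given values on the
separator, that is, on the variables of the bag that also occur above `t`. Thus `M` depends only on
variables in the parent's bag and is added to the parent's table, or to a constant at the root. The
remainder `E` is nonnegative and vanishes at the minimizing extension, which is recorded in `arg`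
(`Eliminated.step`). In the end the energy is a constant plus nonnegative functions of the bags.
Following the recorded choices from the root downwards makes these functions zero one after the
other, because a later choice does not change the variables of earlier bags (`triple_decode`). The
resulting vector attains the constant, a lower bound for the energy.

A bound without an extra factor `k` requires constant amortized time per table entry, on a machine
without bit operations. The subroutine `sums` provides this. It computes the sum of given marks over
every subset of a bag by doubling, at geometrically growing cost (`triple_sums`). Unit marks at the
variables of a term find the entries to which the term contributes. Marks `2 ^ l` on the separator
translate positions in the table of `t`, or of its parent, into positions of separator assignments.

The algorithm is written in a small language with `for` loops and a cost function. Compilation to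
the machine costs only a constant factor (`runs_compile`), and cost and correctness of each part are
proved together as a `Triple`. -/

set_option linter.constructorNameAsVariable false

/-! ### A structured language with `for` loops -/

namespace Loop

/-- Variables of the structured language; they hold natural numbers. -/
inductive Var where
  | n | T | m | ptr | o | t | p | q | i | j | r | l | a | z | b | v | c | key | best | cur

/-- Arrays of natural numbers. -/
inductive Arr where
  | np | off | top | pw | mark | acc | arg | sol

def Var.idx : Var → ℕ
  | n => 0 | T => 1 | m => 2 | ptr => 3 | o => 4 | t => 5 | p => 6 | q => 7 | i => 8 | j => 9
  | r => 10 | l => 11 | a => 12 | z => 13 | b => 14 | v => 15 | c => 16 | key => 17 | best => 18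
  | cur => 19

/-- The number 0 is left to the integer array `tab`. -/
def Arr.idx : Arr → ℕ
  | np => 1 | off => 2 | top => 3 | pw => 4 | mark => 5 | acc => 6 | arg => 7 | sol => 8

theorem Var.idx_injective : Function.Injective Var.idx := by
  intro x y h
  cases x <;> cases y <;> first | rfl | (simp [Var.idx] at h)

theorem Arr.idx_injective : Function.Injective Arr.idx := by
  intro x y h
  cases x <;> cases y <;> first | rfl | (simp [Arr.idx] at h)

/-- Registers from 32 on are thereby free as scratch space of the compiled code. -/
theorem Var.idx_lt (x : Var) : x.idx < 32 := by cases x <;> simp [Var.idx]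

theorem Arr.idx_lt (A : Arr) : A.idx < 16 := by cases A <;> simp [Arr.idx]

theorem Arr.idx_pos (A : Arr) : 0 < A.idx := by cases A <;> simp [Arr.idx]

instance : DecidableEq Var := fun _ _ => decidable_of_iff _ Var.idx_injective.eq_iff

instance : DecidableEq Arr := fun _ _ => decidable_of_iff _ Arr.idx_injective.eq_iff

/-- The variables, the arrays of natural numbers, the array holding input and output, and an array
of integers. -/
structure Store where
  var : Var → ℕ
  arr : Arr → ℕ → ℕ
  raw : ℕ → ℤ
  tab : ℕ → ℤ

def Store.setVar (s : Store) (x : Var) (k : ℕ) : Store :=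
  { s with var := Function.update s.var x k }

def Store.setArr (s : Store) (A : Arr) (i k : ℕ) : Store :=
  { s with arr := Function.update s.arr A (Function.update (s.arr A) i k) }

def Store.setRaw (s : Store) (i : ℕ) (k : ℤ) : Store :=
  { s with raw := Function.update s.raw i k }

def Store.setTab (s : Store) (i : ℕ) (k : ℤ) : Store :=
  { s with tab := Function.update s.tab i k }

/-- Expressions for natural numbers. -/
inductive NExp where
  | lit (k : ℕ)
  | var (x : Var)
  | add (e f : NExp)
  | sub (e f : NExp)
  | arr (A : Arr) (e : NExp)
  | raw (e : NExp)

def NExp.eval (s : Store) : NExp → ℕ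
  | lit k => k
  | var x => s.var x
  | add e f => e.eval s + f.eval s
  | sub e f => e.eval s - f.eval s
  | arr A e => s.arr A (e.eval s)
  | raw e => (s.raw (e.eval s)).toNat

/-- Expressions for integers. -/
inductive IExp where
  | nat (e : NExp)
  | raw (e : NExp)
  | tab (e : NExp)
  | add (e f : IExp)

def IExp.eval (s : Store) : IExp → ℤ
  | nat e => e.eval s
  | raw e => s.raw (e.eval s)
  | tab e => s.tab (e.eval s)
  | add e f => e.eval s + f.eval s

inductive Cmd where
  | set (x : Var) (e : NExp)
  | setArr (A : Arr) (e f : NExp)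
  | setRaw (e : NExp) (f : IExp)
  | setTab (e : NExp) (f : IExp)
  | seq (p q : Cmd)
  /-- if `e < f` then `p` else `q` -/
  | ifLt (e f : IExp) (p q : Cmd)
  /-- execute `p` for `x = 0, …, e - 1`, where `e` is evaluated once -/
  | loop (x : Var) (e : NExp) (p : Cmd)

def iter (f : Store → Store) (x : Var) (s : Store) : ℕ → Store
  | 0 => s
  | k + 1 => f ((iter f x s k).setVar x k)

def Cmd.run : Cmd → Store → Store
  | set x e, s => s.setVar x (e.eval s)
  | setArr A e f, s => s.setArr A (e.eval s) (f.eval s)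
  | setRaw e f, s => s.setRaw (e.eval s) (f.eval s)
  | setTab e f, s => s.setTab (e.eval s) (f.eval s)
  | seq p q, s => q.run (p.run s)
  | ifLt e f p q, s => if e.eval s < f.eval s then p.run s else q.run s
  | loop x e p, s => iter p.run x s (e.eval s)

def Cmd.cost : Cmd → Store → ℕ
  | set _ _, _ => 1
  | setArr _ _ _, _ => 1
  | setRaw _ _, _ => 1
  | setTab _ _, _ => 1
  | seq p q, s => p.cost s + q.cost (p.run s)
  | ifLt e f p q, s => 1 + if e.eval s < f.eval s then p.cost s else q.cost s
  | loop x e p, s => 1 + ∑ k ∈ Finset.range (e.eval s), (1 + p.cost ((iter p.run x s k).setVar x k))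

/-! ### Compilation -/

section Compile

open RAM (Program State Runs)

/-- The address of entry `i` of the array number `r`. -/
def adr (r i : ℕ) : ℤ := -(16 * (i : ℤ) + r + 1)

/-- The arrays are interleaved modulo 16 in the negative cells, and the input and output occupy the
nonnegative ones. Hence all arrays are unbounded and never overlap. The stride is a power of two
because an address must be computed by repeated doubling. -/
theorem adr_inj {r r' i i' : ℕ} (h : r < 16) (h' : r' < 16) :
    adr r i = adr r' i' ↔ r = r' ∧ i = i' := by
  unfold adr; omega

theorem adr_neg (r i : ℕ) : adr r i < 0 := by unfold adr; omega

/-- The machine state `σ` represents the store `s`. -/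
structure Sim (s : Store) (σ : State) : Prop where
  var : ∀ x : Var, σ.reg x.idx = s.var x
  arr : ∀ A i, σ.mem (adr (Arr.idx A) i) = s.arr A i
  raw : ∀ i : ℕ, σ.mem i = s.raw i
  tab : ∀ i : ℕ, σ.mem (adr 0 i) = s.tab i

/-- `r_d := adr r r_d`; the register `r_{d+1}` is overwritten. -/
def addrCode (r d : ℕ) : Program :=
  .seq (.add d d d) (.seq (.add d d d) (.seq (.add d d d) (.seq (.add d d d)
    (.seq (.const (d + 1) (-(r + 1))) (.sub d (d + 1) d)))))

/-- The result is left in `r_d`, and only registers from `d` on serve as scratch space, as on a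
stack. The test for positivity implements truncation at zero. -/
def compileN : NExp → ℕ → Program
  | .lit k, d => .const d k
  | .var x, d => .seq (.const d 0) (.add d d x.idx)
  | .add e f, d => .seq (compileN e d) (.seq (compileN f (d + 1)) (.add d d (d + 1)))
  | .sub e f, d => .seq (compileN e d) (.seq (compileN f (d + 1)) (.seq (.sub d d (d + 1))
      (.ifPos d .skip (.const d 0))))
  | .arr A e, d => .seq (compileN e d) (.seq (addrCode A.idx d) (.load d d))
  | .raw e, d => .seq (compileN e d) (.seq (.load d d) (.ifPos d .skip (.const d 0)))

def compileI : IExp → ℕ → Program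
  | .nat e, d => compileN e d
  | .raw e, d => .seq (compileN e d) (.load d d)
  | .tab e, d => .seq (compileN e d) (.seq (addrCode 0 d) (.load d d))
  | .add e f, d => .seq (compileI e d) (.seq (compileI f (d + 1)) (.add d d (d + 1)))

/-- A loop keeps the number of remaining passes, the index of the pass and the constant 1 in the
hidden registers `d`, `d + 1` and `d + 2`. The loop variable is rewritten from the hidden index
before each pass, so the body may change it without affecting the iteration. -/
def compile : Cmd → ℕ → Program
  | .set x e, d => .seq (compileN e d) (.seq (.const x.idx 0) (.add x.idx x.idx d))
  | .setArr A e f, d => .seq (compileN e d) (.seq (addrCode A.idx d)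
      (.seq (compileN f (d + 1)) (.store d (d + 1))))
  | .setRaw e f, d => .seq (compileN e d) (.seq (compileI f (d + 1)) (.store d (d + 1)))
  | .setTab e f, d => .seq (compileN e d) (.seq (addrCode 0 d)
      (.seq (compileI f (d + 1)) (.store d (d + 1))))
  | .seq p q, d => .seq (compile p d) (compile q d)
  | .ifLt e f p q, d => .seq (compileI e d) (.seq (compileI f (d + 1))
      (.seq (.sub d (d + 1) d) (.ifPos d (compile p d) (compile q d))))
  | .loop x e p, d => .seq (compileN e d) (.seq (.const (d + 1) 0) (.seq (.const (d + 2) 1)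
      (.whilePos d (.seq (.const x.idx 0) (.seq (.add x.idx x.idx (d + 1))
        (.seq (compile p (d + 3)) (.seq (.add (d + 1) (d + 1) (d + 2)) (.sub d d (d + 2)))))))))

/-! ### Behaviour and running time of the compiled code -/

theorem runs_seq {p q : Program} {s s₁ s₂ : State} {t₁ t₂ t : ℕ}
    (h₁ : Runs p s s₁ t₁) (h₂ : Runs q s₁ s₂ t₂) (h : t = t₁ + t₂) : Runs (.seq p q) s s₂ t :=
  h ▸ .seq h₁ h₂

theorem runs_addrCode (r d i : ℕ) (σ : State) (h : σ.reg d = i) :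
    ∃ σ', Runs (addrCode r d) σ σ' 6 ∧ σ'.reg d = adr r i ∧ σ'.mem = σ.mem ∧
      ∀ k < d, σ'.reg k = σ.reg k := by
  refine ⟨_, runs_seq (.add _ _ _ _) (runs_seq (.add _ _ _ _) (runs_seq (.add _ _ _ _)
    (runs_seq (.add _ _ _ _) (runs_seq (.const _ _ _) (.sub _ _ _ _) rfl) rfl) rfl) rfl) rfl,
    ?_, rfl, ?_⟩
  · simp [State.setReg, h, adr]; ring
  · intro k hk
    simp [State.setReg, Function.update_of_ne, hk.ne, show k ≠ d + 1 by omega]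

/-- `σ'` arises from `σ` by changing registers `r_k` with `k ≥ d` only. -/
def Keeps (d : ℕ) (σ σ' : State) : Prop :=
  σ'.mem = σ.mem ∧ ∀ k < d, σ'.reg k = σ.reg k

theorem Keeps.trans {d e : ℕ} {σ σ₁ σ₂ : State} (h : Keeps d σ σ₁) (h' : Keeps e σ₁ σ₂)
    (hde : d ≤ e) : Keeps d σ σ₂ :=
  ⟨h'.1.trans h.1, fun k hk => (h'.2 k (by omega)).trans (h.2 k hk)⟩

theorem Keeps.setReg {d e : ℕ} {σ σ₁ : State} (h : Keeps d σ σ₁) (hde : d ≤ e) (v : ℤ) :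
    Keeps d σ (σ₁.setReg e v) :=
  ⟨h.1, fun k hk => by
    rw [← h.2 k hk]; simp [State.setReg, Function.update_of_ne, show k ≠ e by omega]⟩

theorem Sim.keeps {s : Store} {d : ℕ} {σ σ' : State} (h : Sim s σ) (hd : 32 ≤ d)
    (hk : Keeps d σ σ') : Sim s σ' where
  var x := (hk.2 _ (x.idx_lt.trans_le hd)).trans (h.var x)
  arr A i := by rw [hk.1]; exact h.arr A i
  raw i := by rw [hk.1]; exact h.raw i
  tab i := by rw [hk.1]; exact h.tab i

/-- Both branches take the same time, which makes the running time of an expression independent of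
the store. -/
theorem runs_truncate (d : ℕ) (σ : State) :
    Runs (.ifPos d .skip (.const d 0)) σ
      (if 0 < σ.reg d then σ else σ.setReg d 0) 2 := by
  split_ifs with h
  · exact .ifTrue h (.skip _)
  · exact .ifFalse h (.const _ _ _)

theorem keeps_truncate (d : ℕ) (σ : State) :
    Keeps d σ (if 0 < σ.reg d then σ else σ.setReg d 0) := by
  split_ifs with h
  · exact ⟨rfl, fun _ _ => rfl⟩
  · exact Keeps.setReg ⟨rfl, fun _ _ => rfl⟩ le_rfl _

theorem reg_truncate (d : ℕ) (σ : State) :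
    (if 0 < σ.reg d then σ else σ.setReg d 0).reg d = ((σ.reg d).toNat : ℤ) := by
  split_ifs with h
  · omega
  · simp [State.setReg]; omega

theorem Keeps.refl (d : ℕ) (σ : State) : Keeps d σ σ := ⟨rfl, fun _ _ => rfl⟩

theorem runs_compileN (e : NExp) : ∃ κ : ℕ, ∀ (d : ℕ) (s : Store) (σ : State), 32 ≤ d → Sim s σ →
    ∃ σ', Runs (compileN e d) σ σ' κ ∧ Keeps d σ σ' ∧ σ'.reg d = e.eval s := by
  induction e with
  | lit k =>
    exact ⟨1, fun d s σ hd h => ⟨_, .const _ _ _, (Keeps.refl _ _).setReg le_rfl _,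
      by simp [State.setReg, NExp.eval]⟩⟩
  | var x =>
    refine ⟨2, fun d s σ hd h => ⟨_, runs_seq (.const _ _ _) (.add _ _ _ _) rfl,
      ((Keeps.refl _ _).setReg le_rfl _).setReg le_rfl _, ?_⟩⟩
    have := x.idx_lt
    simp [State.setReg, NExp.eval, Function.update_of_ne, show x.idx ≠ d by omega, h.var]
  | add e f ihe ihf =>
    obtain ⟨κ₁, h₁⟩ := ihe
    obtain ⟨κ₂, h₂⟩ := ihf
    refine ⟨κ₁ + (κ₂ + 1), fun d s σ hd h => ?_⟩
    obtain ⟨σ₁, r₁, k₁, v₁⟩ := h₁ d s σ hd h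
    obtain ⟨σ₂, r₂, k₂, v₂⟩ := h₂ (d + 1) s σ₁ (by omega) (h.keeps hd k₁)
    refine ⟨_, runs_seq r₁ (runs_seq r₂ (.add _ _ _ _) rfl) rfl,
      (k₁.trans k₂ (by omega)).setReg le_rfl _, ?_⟩
    simp [State.setReg, NExp.eval, v₂, k₂.2 d (by omega), v₁]
  | sub e f ihe ihf =>
    obtain ⟨κ₁, h₁⟩ := ihe
    obtain ⟨κ₂, h₂⟩ := ihf
    refine ⟨κ₁ + (κ₂ + (1 + 2)), fun d s σ hd h => ?_⟩
    obtain ⟨σ₁, r₁, k₁, v₁⟩ := h₁ d s σ hd h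
    obtain ⟨σ₂, r₂, k₂, v₂⟩ := h₂ (d + 1) s σ₁ (by omega) (h.keeps hd k₁)
    refine ⟨_, runs_seq r₁ (runs_seq r₂ (runs_seq (.sub _ _ _ _) (runs_truncate _ _) rfl) rfl) rfl,
      ((k₁.trans k₂ (by omega)).setReg le_rfl _).trans (keeps_truncate _ _) le_rfl, ?_⟩
    rw [reg_truncate]
    simp [State.setReg, NExp.eval, v₂, k₂.2 d (by omega), v₁]
  | arr A e ihe =>
    obtain ⟨κ₁, h₁⟩ := ihe
    refine ⟨κ₁ + (6 + 1), fun d s σ hd h => ?_⟩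
    obtain ⟨σ₁, r₁, k₁, v₁⟩ := h₁ d s σ hd h
    obtain ⟨σ₂, r₂, v₂, m₂, k₂⟩ := runs_addrCode A.idx d _ σ₁ v₁
    refine ⟨_, runs_seq r₁ (runs_seq r₂ (.load _ _ _) rfl) rfl,
      (k₁.trans ⟨m₂, k₂⟩ le_rfl).setReg le_rfl _, ?_⟩
    simp [State.setReg, NExp.eval, v₂, m₂, k₁.1, h.arr]
  | raw e ihe =>
    obtain ⟨κ₁, h₁⟩ := ihe
    refine ⟨κ₁ + (1 + 2), fun d s σ hd h => ?_⟩
    obtain ⟨σ₁, r₁, k₁, v₁⟩ := h₁ d s σ hd h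
    refine ⟨_, runs_seq r₁ (runs_seq (.load _ _ _) (runs_truncate _ _) rfl) rfl,
      (k₁.setReg le_rfl _).trans (keeps_truncate _ _) le_rfl, ?_⟩
    rw [reg_truncate]
    simp [State.setReg, NExp.eval, v₁, k₁.1, h.raw]

theorem runs_compileI (e : IExp) : ∃ κ : ℕ, ∀ (d : ℕ) (s : Store) (σ : State), 32 ≤ d → Sim s σ →
    ∃ σ', Runs (compileI e d) σ σ' κ ∧ Keeps d σ σ' ∧ σ'.reg d = e.eval s := by
  induction e with
  | nat e => exact runs_compileN e
  | raw e =>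
    obtain ⟨κ₁, h₁⟩ := runs_compileN e
    refine ⟨κ₁ + 1, fun d s σ hd h => ?_⟩
    obtain ⟨σ₁, r₁, k₁, v₁⟩ := h₁ d s σ hd h
    refine ⟨_, runs_seq r₁ (.load _ _ _) rfl, k₁.setReg le_rfl _, ?_⟩
    simp [State.setReg, IExp.eval, v₁, k₁.1, h.raw]
  | tab e =>
    obtain ⟨κ₁, h₁⟩ := runs_compileN e
    refine ⟨κ₁ + (6 + 1), fun d s σ hd h => ?_⟩
    obtain ⟨σ₁, r₁, k₁, v₁⟩ := h₁ d s σ hd h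
    obtain ⟨σ₂, r₂, v₂, m₂, k₂⟩ := runs_addrCode 0 d _ σ₁ v₁
    refine ⟨_, runs_seq r₁ (runs_seq r₂ (.load _ _ _) rfl) rfl,
      (k₁.trans ⟨m₂, k₂⟩ le_rfl).setReg le_rfl _, ?_⟩
    simp [State.setReg, IExp.eval, v₂, m₂, k₁.1, h.tab]
  | add e f ihe ihf =>
    obtain ⟨κ₁, h₁⟩ := ihe
    obtain ⟨κ₂, h₂⟩ := ihf
    refine ⟨κ₁ + (κ₂ + 1), fun d s σ hd h => ?_⟩
    obtain ⟨σ₁, r₁, k₁, v₁⟩ := h₁ d s σ hd h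
    obtain ⟨σ₂, r₂, k₂, v₂⟩ := h₂ (d + 1) s σ₁ (by omega) (h.keeps hd k₁)
    refine ⟨_, runs_seq r₁ (runs_seq r₂ (.add _ _ _ _) rfl) rfl,
      (k₁.trans k₂ (by omega)).setReg le_rfl _, ?_⟩
    simp [State.setReg, IExp.eval, v₂, k₂.2 d (by omega), v₁]

/-! ### Matching writes to a store and to the machine -/

theorem Sim.setVar {s : Store} {σ : State} (h : Sim s σ) (x : Var) (k : ℕ) :
    Sim (s.setVar x k) (σ.setReg x.idx k) where
  var y := by
    by_cases hy : y = x
    · subst hy; simp [State.setReg, Store.setVar]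
    · simp [State.setReg, Store.setVar, hy, Var.idx_injective.ne hy, h.var]
  arr := h.arr
  raw := h.raw
  tab := h.tab

theorem Sim.setArr {s : Store} {σ : State} (h : Sim s σ) (A : Arr) (i k : ℕ) :
    Sim (s.setArr A i k) (σ.setMem (adr A.idx i) k) where
  var := h.var
  arr B j := by
    simp only [State.setMem, Store.setArr, Function.update_apply, adr_inj B.idx_lt A.idx_lt,
      Arr.idx_injective.eq_iff]
    by_cases hB : B = A
    · subst hB; by_cases hj : j = i <;> simp [hj, h.arr]
    · simp [hB, h.arr]
  raw j := by
    have := adr_neg A.idx i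
    simp [State.setMem, Store.setArr, h.raw,
      show (j : ℤ) ≠ adr A.idx i by omega]
  tab j := by
    simp [State.setMem, Store.setArr, h.tab,
      adr_inj (by norm_num : 0 < 16) A.idx_lt, A.idx_pos.ne]

theorem Sim.setRaw {s : Store} {σ : State} (h : Sim s σ) (i : ℕ) (k : ℤ) :
    Sim (s.setRaw i k) (σ.setMem i k) where
  var := h.var
  arr B j := by
    have := adr_neg B.idx j
    simp [State.setMem, Store.setRaw, h.arr,
      show adr B.idx j ≠ (i : ℤ) by omega]
  raw j := by
    simp [State.setMem, Store.setRaw, Function.update_apply, h.raw]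
  tab j := by
    have := adr_neg 0 j
    simp [State.setMem, Store.setRaw, h.tab,
      show adr 0 j ≠ (i : ℤ) by omega]

theorem Sim.setTab {s : Store} {σ : State} (h : Sim s σ) (i : ℕ) (k : ℤ) :
    Sim (s.setTab i k) (σ.setMem (adr 0 i) k) where
  var := h.var
  arr B j := by
    simp [State.setMem, Store.setTab, h.arr,
      adr_inj B.idx_lt (by norm_num : 0 < 16), B.idx_pos.ne']
  raw j := by
    have := adr_neg 0 i
    simp [State.setMem, Store.setTab, h.raw,
      show (j : ℤ) ≠ adr 0 i by omega]
  tab j := by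
    simp [State.setMem, Store.setTab, Function.update_apply, h.tab,
      adr_inj (by norm_num : 0 < 16) (by norm_num : 0 < 16)]

/-- `σ'` agrees with `σ` on the registers `r_k` with `32 ≤ k < d`. -/
def KeepsHidden (d : ℕ) (σ σ' : State) : Prop := ∀ k, 32 ≤ k → k < d → σ'.reg k = σ.reg k

theorem runs_addVar (x : Var) (d : ℕ) (hd : 32 ≤ d) (σ : State) :
    Runs (.add x.idx x.idx d) (σ.setReg x.idx 0) (σ.setReg x.idx (σ.reg d)) 1 := by
  have := x.idx_lt
  have e : σ.setReg x.idx (σ.reg d) = (σ.setReg x.idx 0).setReg x.idx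
      ((σ.setReg x.idx 0).reg x.idx + (σ.setReg x.idx 0).reg d) := by
    simp [State.setReg, show d ≠ x.idx by omega]
  rw [e]
  exact .add _ _ _ _

theorem runs_setVarCode (x : Var) (d : ℕ) (hd : 32 ≤ d) (σ : State) :
    Runs (.seq (.const x.idx 0) (.add x.idx x.idx d)) σ (σ.setReg x.idx (σ.reg d)) 2 :=
  runs_seq (.const _ _ _) (runs_addVar x d hd σ) rfl

theorem setReg_of_lt {k : ℕ} {x : Var} (hk : 32 ≤ k) (σ : State) (v : ℤ) :
    (σ.setReg x.idx v).reg k = σ.reg k := by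
  have := x.idx_lt
  simp [State.setReg, show k ≠ x.idx by omega]

/-- Induction on the number `r` of remaining passes. The overhead of 5 per pass consists of the
test, two steps to set the loop variable and two to update the hidden registers; the final failing
test accounts for the leading 1. -/
theorem runs_compile_loop {x : Var} {p : Cmd} {κ : ℕ}
    (ih : ∀ (d : ℕ) (s : Store) (σ : State), 32 ≤ d → Sim s σ →
      ∃ σ' t, Runs (compile p d) σ σ' t ∧ KeepsHidden d σ σ' ∧ Sim (p.run s) σ' ∧
        t ≤ κ * p.cost s)
    (d : ℕ) (hd : 32 ≤ d) (s : Store) (N : ℕ) (r : ℕ) :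
    ∀ (k : ℕ) (σ : State), k + r = N → Sim (iter p.run x s k) σ → σ.reg d = r →
      σ.reg (d + 1) = k → σ.reg (d + 2) = 1 →
      ∃ σ' t, Runs (.whilePos d (.seq (.const x.idx 0) (.seq (.add x.idx x.idx (d + 1))
        (.seq (compile p (d + 3)) (.seq (.add (d + 1) (d + 1) (d + 2)) (.sub d d (d + 2))))))) σ σ' t ∧
        KeepsHidden d σ σ' ∧ Sim (iter p.run x s N) σ' ∧
        t ≤ 1 + ∑ i ∈ Finset.Ico k N, (5 + κ * p.cost ((iter p.run x s i).setVar x i)) := by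
  induction r with
  | zero =>
    intro k σ hk hs h0 h1 h2
    obtain rfl : k = N := by omega
    exact ⟨σ, 1, .whileFalse (by simp [h0]), fun _ _ _ => rfl, hs, by simp⟩
  | succ r ihr =>
    intro k σ hk hs h0 h1 h2
    have hx := hs.setVar x k
    rw [← h1] at hx
    obtain ⟨σ₁, t₁, r₁, k₁, s₁, c₁⟩ := ih (d + 3) _ _ (by omega) hx
    have e0 : σ₁.reg d = r + 1 := by
      rw [k₁ d hd (by omega), setReg_of_lt hd, h0]; push_cast; ring
    have e1 : σ₁.reg (d + 1) = k := by
      rw [k₁ _ (by omega) (by omega), setReg_of_lt (by omega), h1]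
    have e2 : σ₁.reg (d + 2) = 1 := by
      rw [k₁ _ (by omega) (by omega), setReg_of_lt (by omega), h2]
    set σ₂ := σ₁.setReg (d + 1) (k + 1) with hσ₂
    set σ₃ := σ₂.setReg d r with hσ₃
    have a₂ : Runs (.add (d + 1) (d + 1) (d + 2)) σ₁ σ₂ 1 := by
      have := Runs.add σ₁ (d + 1) (d + 1) (d + 2)
      rwa [e1, e2] at this
    have a₃ : Runs (.sub d d (d + 2)) σ₂ σ₃ 1 := by
      have := Runs.sub σ₂ d d (d + 2)
      have f : σ₂.reg d - σ₂.reg (d + 2) = r := by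
        simp [hσ₂, State.setReg, e0, e2]
      rwa [f] at this
    have kk : Keeps d σ₁ σ₃ := ((Keeps.refl _ _).setReg (by omega) _).setReg le_rfl _
    have hs₃ : Sim (iter p.run x s (k + 1)) σ₃ := s₁.keeps hd kk
    obtain ⟨σ', t, rr, k', s', c'⟩ := ihr (k + 1) σ₃ (by omega) hs₃
      (by simp [hσ₃, State.setReg]) (by simp [hσ₃, hσ₂, State.setReg])
      (by simp [hσ₃, hσ₂, State.setReg, e2])
    have body : Runs (.seq (.const x.idx 0) (.seq (.add x.idx x.idx (d + 1))
        (.seq (compile p (d + 3)) (.seq (.add (d + 1) (d + 1) (d + 2)) (.sub d d (d + 2)))))) σ σ₃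
          (t₁ + 4) := by
      exact runs_seq (.const _ _ _) (runs_seq (runs_addVar x (d + 1) (by omega) σ)
        (runs_seq r₁ (runs_seq a₂ a₃ rfl) rfl) rfl) (by omega)
    refine ⟨σ', _, .whileTrue (by rw [h0]; push_cast; omega) body rr, ?_, s', ?_⟩
    · intro j hj hjd
      rw [k' j hj hjd, kk.2 j hjd, k₁ j hj (by omega), setReg_of_lt hj]
    · rw [Finset.sum_eq_sum_Ico_succ_bot (by omega : k < N)]
      rw [h1] at *
      omega

/-- The factor `κ` is chosen before the store, so compilation loses only a constant depending on the
program. It exists because expressions have fixed cost, and each loop pass contributes at least one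
to `Cmd.cost`, which pays for its overhead. -/
theorem runs_compile (c : Cmd) : ∃ κ : ℕ, ∀ (d : ℕ) (s : Store) (σ : State), 32 ≤ d → Sim s σ →
    ∃ σ' t, Runs (compile c d) σ σ' t ∧ KeepsHidden d σ σ' ∧ Sim (c.run s) σ' ∧
      t ≤ κ * c.cost s := by
  induction c with
  | set x e =>
    obtain ⟨κ₁, h₁⟩ := runs_compileN e
    refine ⟨κ₁ + 2, fun d s σ hd h => ?_⟩
    obtain ⟨σ₁, r₁, k₁, v₁⟩ := h₁ d s σ hd h
    refine ⟨_, _, runs_seq r₁ (runs_setVarCode x d hd _) rfl, ?_, ?_, by simp [Cmd.cost]⟩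
    · intro k hk hkd
      rw [setReg_of_lt hk, k₁.2 k hkd]
    · rw [v₁]; exact (h.keeps hd k₁).setVar x _
  | setArr A e f =>
    obtain ⟨κ₁, h₁⟩ := runs_compileN e
    obtain ⟨κ₂, h₂⟩ := runs_compileN f
    refine ⟨κ₁ + (6 + (κ₂ + 1)), fun d s σ hd h => ?_⟩
    obtain ⟨σ₁, r₁, k₁, v₁⟩ := h₁ d s σ hd h
    obtain ⟨σ₂, r₂, v₂, m₂, k₂⟩ := runs_addrCode A.idx d _ σ₁ v₁
    have k₂' := k₁.trans ⟨m₂, k₂⟩ le_rfl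
    obtain ⟨σ₃, r₃, k₃, v₃⟩ := h₂ (d + 1) s σ₂ (by omega) (h.keeps hd k₂')
    refine ⟨_, _, runs_seq r₁ (runs_seq r₂ (runs_seq r₃ (.store _ _ _) rfl) rfl) rfl, ?_, ?_,
      by simp [Cmd.cost]⟩
    · intro k hk hkd
      exact (k₂'.trans k₃ (by omega)).2 k hkd
    · rw [v₃, k₃.2 d (by omega), v₂]
      exact (h.keeps hd (k₂'.trans k₃ (by omega))).setArr A _ _
  | setRaw e f =>
    obtain ⟨κ₁, h₁⟩ := runs_compileN e
    obtain ⟨κ₂, h₂⟩ := runs_compileI f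
    refine ⟨κ₁ + (κ₂ + 1), fun d s σ hd h => ?_⟩
    obtain ⟨σ₁, r₁, k₁, v₁⟩ := h₁ d s σ hd h
    obtain ⟨σ₃, r₃, k₃, v₃⟩ := h₂ (d + 1) s σ₁ (by omega) (h.keeps hd k₁)
    refine ⟨_, _, runs_seq r₁ (runs_seq r₃ (.store _ _ _) rfl) rfl, ?_, ?_,
      by simp [Cmd.cost]⟩
    · intro k hk hkd
      exact (k₁.trans k₃ (by omega)).2 k hkd
    · rw [v₃, k₃.2 d (by omega), v₁]
      exact (h.keeps hd (k₁.trans k₃ (by omega))).setRaw _ _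
  | setTab e f =>
    obtain ⟨κ₁, h₁⟩ := runs_compileN e
    obtain ⟨κ₂, h₂⟩ := runs_compileI f
    refine ⟨κ₁ + (6 + (κ₂ + 1)), fun d s σ hd h => ?_⟩
    obtain ⟨σ₁, r₁, k₁, v₁⟩ := h₁ d s σ hd h
    obtain ⟨σ₂, r₂, v₂, m₂, k₂⟩ := runs_addrCode 0 d _ σ₁ v₁
    have k₂' := k₁.trans ⟨m₂, k₂⟩ le_rfl
    obtain ⟨σ₃, r₃, k₃, v₃⟩ := h₂ (d + 1) s σ₂ (by omega) (h.keeps hd k₂')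
    refine ⟨_, _, runs_seq r₁ (runs_seq r₂ (runs_seq r₃ (.store _ _ _) rfl) rfl) rfl, ?_, ?_,
      by simp [Cmd.cost]⟩
    · intro k hk hkd
      exact (k₂'.trans k₃ (by omega)).2 k hkd
    · rw [v₃, k₃.2 d (by omega), v₂]
      exact (h.keeps hd (k₂'.trans k₃ (by omega))).setTab _ _
  | seq p q ihp ihq =>
    obtain ⟨κ₁, h₁⟩ := ihp
    obtain ⟨κ₂, h₂⟩ := ihq
    refine ⟨κ₁ + κ₂, fun d s σ hd h => ?_⟩
    obtain ⟨σ₁, t₁, r₁, k₁, s₁, c₁⟩ := h₁ d s σ hd h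
    obtain ⟨σ₂, t₂, r₂, k₂, s₂, c₂⟩ := h₂ d _ σ₁ hd s₁
    refine ⟨_, _, runs_seq r₁ r₂ rfl, fun k hk hkd => (k₂ k hk hkd).trans (k₁ k hk hkd), s₂, ?_⟩
    simp only [Cmd.cost]
    nlinarith [Nat.zero_le (κ₁ * q.cost (p.run s)), Nat.zero_le (κ₂ * p.cost s)]
  | ifLt e f p q ihp ihq =>
    obtain ⟨κ₁, h₁⟩ := runs_compileI e
    obtain ⟨κ₂, h₂⟩ := runs_compileI f
    obtain ⟨κ₃, h₃⟩ := ihp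
    obtain ⟨κ₄, h₄⟩ := ihq
    refine ⟨κ₁ + κ₂ + κ₃ + κ₄ + 2, fun d s σ hd h => ?_⟩
    obtain ⟨σ₁, r₁, k₁, v₁⟩ := h₁ d s σ hd h
    obtain ⟨σ₂, r₂, k₂, v₂⟩ := h₂ (d + 1) s σ₁ (by omega) (h.keeps hd k₁)
    have k₃ := (k₁.trans k₂ (by omega)).setReg le_rfl (f.eval s - e.eval s)
    have r₃ := Runs.sub σ₂ d (d + 1) d
    rw [v₂, k₂.2 d (by omega), v₁] at r₃
    have hv : (σ₂.setReg d (f.eval s - e.eval s)).reg d = f.eval s - e.eval s := by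
      simp [State.setReg]
    by_cases hlt : e.eval s < f.eval s
    · obtain ⟨σ₄, t₄, r₄, k₄, s₄, c₄⟩ := h₃ d s _ hd (h.keeps hd k₃)
      refine ⟨_, _, runs_seq r₁ (runs_seq r₂ (runs_seq r₃ (.ifTrue ?_ r₄) rfl) rfl) rfl,
        fun k hk hkd => (k₄ k hk hkd).trans (k₃.2 k hkd), by simpa [Cmd.run, hlt] using s₄, ?_⟩
      · rw [hv]; omega
      · simp only [Cmd.cost, hlt, if_true]
        nlinarith [Nat.zero_le ((κ₁ + κ₂ + κ₄ + 2) * p.cost s)]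
    · obtain ⟨σ₄, t₄, r₄, k₄, s₄, c₄⟩ := h₄ d s _ hd (h.keeps hd k₃)
      refine ⟨_, _, runs_seq r₁ (runs_seq r₂ (runs_seq r₃ (.ifFalse ?_ r₄) rfl) rfl) rfl,
        fun k hk hkd => (k₄ k hk hkd).trans (k₃.2 k hkd), by simpa [Cmd.run, hlt] using s₄, ?_⟩
      · rw [hv]; omega
      · simp only [Cmd.cost, hlt, if_false]
        nlinarith [Nat.zero_le ((κ₁ + κ₂ + κ₃ + 2) * q.cost s)]
  | loop x e p ih =>
    obtain ⟨κ₁, h₁⟩ := runs_compileN e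
    obtain ⟨κ₂, h₂⟩ := ih
    refine ⟨κ₁ + κ₂ + 5, fun d s σ hd h => ?_⟩
    obtain ⟨σ₁, r₁, k₁, v₁⟩ := h₁ d s σ hd h
    have k₃ := (k₁.setReg (by omega : d ≤ d + 1) 0).setReg (by omega : d ≤ d + 2) 1
    obtain ⟨σ', t, r', k', s', c'⟩ := runs_compile_loop (x := x) h₂ d hd s (e.eval s) (e.eval s) 0
      ((σ₁.setReg (d + 1) 0).setReg (d + 2) 1) (by omega) (h.keeps hd k₃)
      (by simp [State.setReg, v₁]) (by simp [State.setReg]) (by simp [State.setReg])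
    refine ⟨_, _, runs_seq r₁ (runs_seq (.const _ _ _) (runs_seq (.const _ _ _) r' rfl) rfl) rfl,
      fun k hk hkd => (k' k hk hkd).trans (k₃.2 k hkd), s', ?_⟩
    have : ∑ i ∈ Finset.Ico 0 (e.eval s), (5 + κ₂ * p.cost ((iter p.run x s i).setVar x i))
        ≤ (κ₁ + κ₂ + 5) *
          ∑ i ∈ Finset.range (e.eval s), (1 + p.cost ((iter p.run x s i).setVar x i)) := by
      rw [Finset.mul_sum, Nat.Ico_zero_eq_range]
      refine Finset.sum_le_sum fun i _ => ?_
      nlinarith [Nat.zero_le ((κ₁ + 5) * p.cost ((iter p.run x s i).setVar x i))]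
    simp only [Cmd.cost]
    nlinarith

end Compile

end Loop

namespace Loop

/-! ### Reasoning about programs of the structured language -/

/-- A syntactic overapproximation. Since it evaluates to a Boolean, most preservation facts about
concrete programs reduce to `rfl`. -/
def Cmd.writesVar (y : Var) : Cmd → Bool
  | set x _ => decide (x = y)
  | setArr _ _ _ => false
  | setRaw _ _ => false
  | setTab _ _ => false
  | seq p q => p.writesVar y || q.writesVar y
  | ifLt _ _ p q => p.writesVar y || q.writesVar y
  | loop x _ p => decide (x = y) || p.writesVar y

def Cmd.writesArr (B : Arr) : Cmd → Bool
  | set _ _ => false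
  | setArr A _ _ => decide (A = B)
  | setRaw _ _ => false
  | setTab _ _ => false
  | seq p q => p.writesArr B || q.writesArr B
  | ifLt _ _ p q => p.writesArr B || q.writesArr B
  | loop _ _ p => p.writesArr B

def Cmd.writesRaw : Cmd → Bool
  | set _ _ => false
  | setArr _ _ _ => false
  | setRaw _ _ => true
  | setTab _ _ => false
  | seq p q => p.writesRaw || q.writesRaw
  | ifLt _ _ p q => p.writesRaw || q.writesRaw
  | loop _ _ p => p.writesRaw

def Cmd.writesTab : Cmd → Bool
  | set _ _ => false
  | setArr _ _ _ => false
  | setRaw _ _ => false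
  | setTab _ _ => true
  | seq p q => p.writesTab || q.writesTab
  | ifLt _ _ p q => p.writesTab || q.writesTab
  | loop _ _ p => p.writesTab

/-- `s'` differs from `s` only in places to which `c` writes. -/
structure Frame (c : Cmd) (s s' : Store) : Prop where
  var : ∀ x, c.writesVar x = false → s'.var x = s.var x
  arr : ∀ A, c.writesArr A = false → s'.arr A = s.arr A
  raw : c.writesRaw = false → s'.raw = s.raw
  tab : c.writesTab = false → s'.tab = s.tab

theorem Frame.refl (c : Cmd) (s : Store) : Frame c s s :=
  ⟨fun _ _ => rfl, fun _ _ => rfl, fun _ => rfl, fun _ => rfl⟩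

theorem Frame.trans {c c₁ c₂ : Cmd} {s s₁ s₂ : Store} (h₁ : Frame c₁ s s₁) (h₂ : Frame c₂ s₁ s₂)
    (hv : ∀ x, c.writesVar x = false → c₁.writesVar x = false ∧ c₂.writesVar x = false)
    (ha : ∀ A, c.writesArr A = false → c₁.writesArr A = false ∧ c₂.writesArr A = false)
    (hr : c.writesRaw = false → c₁.writesRaw = false ∧ c₂.writesRaw = false)
    (ht : c.writesTab = false → c₁.writesTab = false ∧ c₂.writesTab = false) :
    Frame c s s₂ where
  var x h := (h₂.var x (hv x h).2).trans (h₁.var x (hv x h).1)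
  arr A h := (h₂.arr A (ha A h).2).trans (h₁.arr A (ha A h).1)
  raw h := (h₂.raw (hr h).2).trans (h₁.raw (hr h).1)
  tab h := (h₂.tab (ht h).2).trans (h₁.tab (ht h).1)

/-- The statement covers every intermediate pass, so that preserved quantities need not be part of a
loop invariant. -/
theorem frame_iter {x : Var} {e : NExp} {p : Cmd} (ih : ∀ s, Frame p s (p.run s)) (s : Store)
    (k : ℕ) : Frame (.loop x e p) s (iter p.run x s k) := by
  induction k with
  | zero => exact Frame.refl _ _
  | succ k ihk =>
    have hf := ih ((iter p.run x s k).setVar x k)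
    refine ⟨fun y h => ?_, fun A h => ?_, fun h => ?_, fun h => ?_⟩
    · simp only [Cmd.writesVar, Bool.or_eq_false_iff, decide_eq_false_iff_not] at h
      rw [iter, hf.var y h.2, ← ihk.var y (by simp [Cmd.writesVar, h])]
      simp [Store.setVar, Function.update_of_ne (Ne.symm h.1)]
    · rw [iter, hf.arr A h, ← ihk.arr A h]; rfl
    · rw [iter, hf.raw h, ← ihk.raw h]; rfl
    · rw [iter, hf.tab h, ← ihk.tab h]; rfl

theorem frame (c : Cmd) : ∀ s, Frame c s (c.run s) := by
  induction c with
  | set x e =>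
    refine fun s => ⟨fun y h => ?_, fun A h => rfl, fun h => rfl, fun h => rfl⟩
    simp only [Cmd.writesVar, decide_eq_false_iff_not] at h
    simp [Cmd.run, Store.setVar, Function.update_of_ne (Ne.symm h)]
  | setArr A e f =>
    refine fun s => ⟨fun y h => rfl, fun B h => ?_, fun h => rfl, fun h => rfl⟩
    simp only [Cmd.writesArr, decide_eq_false_iff_not] at h
    simp [Cmd.run, Store.setArr, Function.update_of_ne (Ne.symm h)]
  | setRaw e f =>
    exact fun s => ⟨fun y h => rfl, fun B h => rfl, fun h => by simp [Cmd.writesRaw] at h,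
      fun h => rfl⟩
  | setTab e f =>
    exact fun s => ⟨fun y h => rfl, fun B h => rfl, fun h => rfl,
      fun h => by simp [Cmd.writesTab] at h⟩
  | seq p q ihp ihq =>
    refine fun s => (ihp s).trans (ihq _) (fun x h => ?_) (fun x h => ?_) (fun h => ?_)
      (fun h => ?_) <;>
    simpa [Cmd.writesVar, Cmd.writesArr, Cmd.writesRaw, Cmd.writesTab] using h
  | ifLt e f p q ihp ihq =>
    intro s
    simp only [Cmd.run]
    split_ifs
    · refine (ihp s).trans (Frame.refl p _) (fun x h => ?_) (fun x h => ?_) (fun h => ?_)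
        (fun h => ?_) <;>
      simp only [Cmd.writesVar, Cmd.writesArr, Cmd.writesRaw, Cmd.writesTab,
        Bool.or_eq_false_iff] at h <;> simp [h]
    · refine (ihq s).trans (Frame.refl q _) (fun x h => ?_) (fun x h => ?_) (fun h => ?_)
        (fun h => ?_) <;>
      simp only [Cmd.writesVar, Cmd.writesArr, Cmd.writesRaw, Cmd.writesTab,
        Bool.or_eq_false_iff] at h <;> simp [h]
  | loop x e p ih => exact fun s => frame_iter ih s _

/-- Started in `s`, the program `c` has cost at most `B` and ends in a store satisfying `Q`. -/
def Triple (c : Cmd) (s : Store) (B : ℕ) (Q : Store → Prop) : Prop :=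
  c.cost s ≤ B ∧ Q (c.run s)

theorem Triple.mono {c : Cmd} {s : Store} {B B' : ℕ} {Q Q' : Store → Prop} (h : Triple c s B Q)
    (hB : B ≤ B') (hQ : ∀ s', Frame c s s' → Q s' → Q' s') : Triple c s B' Q' :=
  ⟨h.1.trans hB, hQ _ (frame c s) h.2⟩

/-- The frame is handed to the second program, so the intermediate assertion `R` only has to mention
what `p` changes. -/
theorem Triple.seq {p q : Cmd} {s : Store} {B₁ B₂ : ℕ} {R Q : Store → Prop}
    (hp : Triple p s B₁ R) (hq : ∀ s', Frame p s s' → R s' → Triple q s' B₂ Q) :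
    Triple (.seq p q) s (B₁ + B₂) Q :=
  have h := hq _ (frame p s) hp.2
  ⟨Nat.add_le_add hp.1 h.1, h.2⟩

theorem Triple.set {x : Var} {e : NExp} {q : Cmd} {s : Store} {B : ℕ} {Q : Store → Prop}
    (h : Triple q (s.setVar x (e.eval s)) B Q) : Triple (.seq (.set x e) q) s (1 + B) Q :=
  ⟨Nat.add_le_add_left h.1 1, h.2⟩

theorem Triple.setArr {A : Arr} {e f : NExp} {q : Cmd} {s : Store} {B : ℕ} {Q : Store → Prop}
    (h : Triple q (s.setArr A (e.eval s) (f.eval s)) B Q) :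
    Triple (.seq (.setArr A e f) q) s (1 + B) Q :=
  ⟨Nat.add_le_add_left h.1 1, h.2⟩

/-- The bound for a pass may depend on its number; `sums` needs this for its geometric series. -/
theorem Triple.loop {x : Var} {e : NExp} {p : Cmd} {s : Store} (N : ℕ) (hN : e.eval s = N)
    (B : ℕ → ℕ) (Inv : ℕ → Store → Prop) (h0 : Inv 0 s)
    (hstep : ∀ k < N, ∀ s', Frame (.loop x e p) s s' → Inv k s' →
      Triple p (s'.setVar x k) (B k) (Inv (k + 1))) :
    Triple (.loop x e p) s (1 + ∑ k ∈ Finset.range N, (1 + B k)) (Inv N) := by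
  have key : ∀ k ≤ N, Inv k (iter p.run x s k) := by
    intro k hk
    induction k with
    | zero => exact h0
    | succ k ih => exact (hstep k hk _ (frame_iter (frame p) s k) (ih (by omega))).2
  refine ⟨?_, ?_⟩
  · simp only [Cmd.cost, hN]
    gcongr with k hk
    rw [Finset.mem_range] at hk
    exact (hstep k hk _ (frame_iter (frame p) s k) (key k hk.le)).1
  · simp only [Cmd.run, hN]
    exact key N le_rfl

theorem Triple.loop_const {x : Var} {e : NExp} {p : Cmd} {s : Store} (N : ℕ) (hN : e.eval s = N)
    (B : ℕ) (Inv : ℕ → Store → Prop) (h0 : Inv 0 s)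
    (hstep : ∀ k < N, ∀ s', Frame (.loop x e p) s s' → Inv k s' →
      Triple p (s'.setVar x k) B (Inv (k + 1))) :
    Triple (.loop x e p) s (1 + N * (1 + B)) (Inv N) :=
  (Triple.loop N hN (fun _ => B) Inv h0 hstep).mono (by simp) fun _ _ h => h

def Cmd.skip : Cmd := .set .cur (.var .cur)

theorem run_skip (s : Store) : Cmd.skip.run s = s := by
  simp [Cmd.skip, Cmd.run, Store.setVar, NExp.eval]

theorem cost_skip (s : Store) : Cmd.skip.cost s = 1 := rfl

end Loop

/-! ### Binary representations -/

/-- The number with the binary digits `y 0, …, y (b - 1)`. -/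
def binary (b : ℕ) (y : ℕ → Bool) : ℕ := ∑ l ∈ Finset.range b, (y l).toNat * 2 ^ l

theorem binary_succ (b : ℕ) (y : ℕ → Bool) :
    binary (b + 1) y = binary b y + (y b).toNat * 2 ^ b := Finset.sum_range_succ _ _

theorem binary_lt (b : ℕ) (y : ℕ → Bool) : binary b y < 2 ^ b := by
  induction b with
  | zero => simp [binary]
  | succ b ih =>
    rw [binary_succ, pow_succ]
    cases y b <;> simp <;> omega

theorem binary_congr {b : ℕ} {y z : ℕ → Bool} (h : ∀ l < b, y l = z l) : binary b y = binary b z :=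
  Finset.sum_congr rfl fun l hl => by rw [h l (Finset.mem_range.mp hl)]

/-- The lower digits contribute less than `2 ^ b`, so the top digit is determined first. -/
theorem binary_inj {b : ℕ} {y z : ℕ → Bool} (h : binary b y = binary b z) : ∀ l < b, y l = z l := by
  induction b with
  | zero => simp
  | succ b ih =>
    rw [binary_succ, binary_succ] at h
    have h1 := binary_lt b y
    have h2 := binary_lt b z
    have hb : y b = z b := by
      cases hy : y b <;> cases hz : z b <;> simp [hy, hz] at h ⊢ <;> omega
    intro l hl
    rcases Nat.lt_succ_iff_lt_or_eq.mp hl with hl | rfl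
    · exact ih (by rw [hb] at h; omega) l hl
    · exact hb

theorem exists_binary_eq {b a : ℕ} (h : a < 2 ^ b) : ∃ y, binary b y = a := by
  induction b generalizing a with
  | zero => exact ⟨fun _ => false, by simp [binary] at h ⊢; omega⟩
  | succ b ih =>
    rw [pow_succ] at h
    by_cases hab : a < 2 ^ b
    · obtain ⟨y, hy⟩ := ih hab
      refine ⟨Function.update y b false, ?_⟩
      rw [binary_succ, binary_congr (z := y) fun l hl => by simp [hl.ne], hy]; simp
    · obtain ⟨y, hy⟩ := ih (show a - 2 ^ b < 2 ^ b by omega)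
      refine ⟨Function.update y b true, ?_⟩
      rw [binary_succ, binary_congr (z := y) fun l hl => by simp [hl.ne], hy]; simp; omega

/-! ### Instances -/

/-- The data of a Hamiltonian with a rooted tree decomposition, as stored in the input. The number
of variables, terms and nodes is `n`, `T` and `m`; the `q`-th term is `wt q * x (ti q) * x (tj q)`;
the parent of the node `t` is `par t` and its bag consists of the `bg t l` with `l < bl t`; the
topmost node containing `v` is `top v`. -/
structure Inst where
  n : ℕ
  T : ℕ
  m : ℕ
  inp : ℕ → ℤ
  ti : ℕ → ℕ
  tj : ℕ → ℕ
  wt : ℕ → ℤ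
  par : ℕ → ℕ
  bl : ℕ → ℕ
  bg : ℕ → ℕ → ℕ
  top : ℕ → ℕ

namespace Inst

variable (I : Inst)

/-- The address at which the description of the node `t` begins. -/
def np (t : ℕ) : ℕ := 3 + (I.T + I.T + I.T) + ∑ u ∈ Finset.range t, (2 + I.bl u)

/-- The position at which the table of the node `t` begins. -/
def off (t : ℕ) : ℕ := ∑ u ∈ Finset.range t, 2 ^ I.bl u

/-- The variable `v` is in the bag of `t`. -/
def Mem (t v : ℕ) : Prop := ∃ l < I.bl t, I.bg t l = v

/-- The node at which the `q`-th term is counted. -/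
def node (q : ℕ) : ℕ := max (I.top (I.ti q)) (I.top (I.tj q))

/-- The position of the restriction of `x` to the bag of `t` in the table of `t`. -/
def idx (t : ℕ) (x : ℕ → Bool) : ℕ := binary (I.bl t) fun l => x (I.bg t l)

/-- The position of the restriction of `x` to the part of the bag of `t` that occurs above `t`. -/
def sep (t : ℕ) (x : ℕ → Bool) : ℕ :=
  binary (I.bl t) fun l => decide (I.top (I.bg t l) < t) && x (I.bg t l)

def energy (x : ℕ → Bool) : ℤ :=
  ∑ q ∈ Finset.range I.T, if x (I.ti q) && x (I.tj q) then I.wt q else 0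

/-- Besides the layout of the input, these are the only properties of the decomposition that the
algorithm uses. Connectedness enters through `par_mem`, and covering through `ti_mem` and `tj_mem`.
-/
structure Valid : Prop where
  inp_n : I.inp 0 = I.n
  inp_T : I.inp 1 = I.T
  inp_ti : ∀ q < I.T, I.inp (2 + (q + q + q)) = I.ti q
  inp_tj : ∀ q < I.T, I.inp (2 + (q + q + q) + 1) = I.tj q
  inp_wt : ∀ q < I.T, I.inp (2 + (q + q + q) + 2) = I.wt q
  inp_m : I.inp (2 + (I.T + I.T + I.T)) = I.m
  inp_par : ∀ t < I.m, I.inp (I.np t) = I.par t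
  inp_bl : ∀ t < I.m, I.inp (I.np t + 1) = I.bl t
  inp_bg : ∀ t < I.m, ∀ l < I.bl t, I.inp (I.np t + 2 + l) = I.bg t l
  bl_le : ∀ t < I.m, I.bl t ≤ I.n
  bg_lt : ∀ t < I.m, ∀ l < I.bl t, I.bg t l < I.n
  bg_inj : ∀ t < I.m, ∀ l < I.bl t, ∀ l' < I.bl t, I.bg t l = I.bg t l' → l = l'
  par_zero : I.par 0 = 0
  par_lt : ∀ t < I.m, 0 < t → I.par t < t
  top_lt : ∀ v < I.n, I.top v < I.m
  top_mem : ∀ v < I.n, I.Mem (I.top v) v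
  top_le : ∀ t < I.m, ∀ v, I.Mem t v → I.top v ≤ t
  par_mem : ∀ t < I.m, ∀ v, I.Mem t v → I.top v < t → I.Mem (I.par t) v
  ti_mem : ∀ q < I.T, I.Mem (I.node q) (I.ti q)
  tj_mem : ∀ q < I.T, I.Mem (I.node q) (I.tj q)
  ti_lt : ∀ q < I.T, I.ti q < I.n
  tj_lt : ∀ q < I.T, I.tj q < I.n

variable {I}

theorem idx_lt (t : ℕ) (x : ℕ → Bool) : I.idx t x < 2 ^ I.bl t := binary_lt _ _

theorem sep_lt (t : ℕ) (x : ℕ → Bool) : I.sep t x < 2 ^ I.bl t := binary_lt _ _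

theorem off_succ (t : ℕ) : I.off (t + 1) = I.off t + 2 ^ I.bl t := Finset.sum_range_succ _ _

theorem np_succ (t : ℕ) : I.np (t + 1) = I.np t + (2 + I.bl t) := by
  unfold np; rw [Finset.sum_range_succ, ← add_assoc]

theorem off_le {t u : ℕ} (h : t < u) : I.off t + 2 ^ I.bl t ≤ I.off u := by
  rw [← off_succ]
  exact Finset.sum_le_sum_of_subset (Finset.range_mono h)

/-- The tables of different nodes occupy disjoint blocks. -/
theorem off_add_eq {t u a c : ℕ} (ha : a < 2 ^ I.bl t) (hc : c < 2 ^ I.bl u) :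
    I.off t + a = I.off u + c ↔ t = u ∧ a = c := by
  constructor
  · intro h
    rcases lt_trichotomy t u with htu | rfl | htu
    · have := off_le (I := I) htu; omega
    · exact ⟨rfl, by omega⟩
    · have := off_le (I := I) htu; omega
  · rintro ⟨rfl, rfl⟩; rfl

theorem idx_congr {t : ℕ} {x y : ℕ → Bool} (h : ∀ v, I.Mem t v → x v = y v) :
    I.idx t x = I.idx t y :=
  binary_congr fun l hl => h _ ⟨l, hl, rfl⟩

theorem sep_congr {t : ℕ} {x y : ℕ → Bool} (h : ∀ v, I.Mem t v → I.top v < t → x v = y v) :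
    I.sep t x = I.sep t y :=
  binary_congr fun l hl => by
    by_cases ht : I.top (I.bg t l) < t
    · simp [h _ ⟨l, hl, rfl⟩ ht]
    · simp [ht]

theorem eq_of_sep_eq {t : ℕ} {x y : ℕ → Bool} (h : I.sep t x = I.sep t y) {v : ℕ} (hv : I.Mem t v)
    (ht : I.top v < t) : x v = y v := by
  obtain ⟨l, hl, rfl⟩ := hv
  simpa [ht] using binary_inj h l hl

theorem eq_of_idx_eq {t : ℕ} {x y : ℕ → Bool} (h : I.idx t x = I.idx t y) {v : ℕ}
    (hv : I.Mem t v) : x v = y v := by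
  obtain ⟨l, hl, rfl⟩ := hv
  exact binary_inj h l hl

/-- The entries of a bag are distinct, so every pattern of digits comes from an assignment. A loop
over table positions can then be treated as a loop over assignments. -/
theorem Valid.exists_idx_eq (hI : I.Valid) {t a : ℕ} (ht : t < I.m) (h : a < 2 ^ I.bl t) :
    ∃ x, I.idx t x = a := by
  classical
  obtain ⟨y, rfl⟩ := exists_binary_eq h
  refine ⟨fun v => decide (∃ l < I.bl t, I.bg t l = v ∧ y l = true), binary_congr fun l hl => ?_⟩
  rw [Bool.eq_iff_iff, decide_eq_true_iff]
  constructor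
  · rintro ⟨l', hl', he, hy⟩
    rwa [← hI.bg_inj t ht l' hl' l hl he]
  · exact fun hy => ⟨l, hl, rfl, hy⟩

/-- A sum over a bag of a function supported in the bag. -/
theorem Valid.sum_bag (hI : I.Valid) {t : ℕ} (ht : t < I.m) (g : ℕ → ℕ)
    (hg : ∀ v, g v ≠ 0 → I.Mem t v) :
    ∑ l ∈ Finset.range (I.bl t), g (I.bg t l) = ∑ v ∈ Finset.range I.n, g v := by
  rw [← Finset.sum_image (s := Finset.range (I.bl t)) (g := I.bg t) (f := g)]
  · refine Finset.sum_subset ?_ ?_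
    · intro v hv
      simp only [Finset.mem_image, Finset.mem_range] at hv ⊢
      obtain ⟨l, hl, rfl⟩ := hv
      exact hI.bg_lt t ht l hl
    · intro v _ hv
      by_contra h
      obtain ⟨l, hl, rfl⟩ := hg v h
      exact hv (Finset.mem_image_of_mem _ (Finset.mem_range.mpr hl))
  · intro l hl l' hl' h
    simp only [Finset.coe_range, Set.mem_Iio] at hl hl'
    exact hI.bg_inj t ht l hl l' hl' h

end Inst

namespace Loop

/-! ### The algorithm -/

/-- `acc[a]`, for every subset `a` of the bag of the node `x`, becomes the sum of `mark` over the
elements of `a`. -/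
def sums (x : Var) : Cmd :=
  .seq (.set .z (.arr .np (.var x)))
  (.seq (.set .b (.raw (.add (.var .z) (.lit 1))))
  (.seq (.setArr .acc (.lit 0) (.lit 0))
  (.loop .l (.var .b)
    (.seq (.set .v (.raw (.add (.add (.var .z) (.lit 2)) (.var .l))))
    (.seq (.set .c (.arr .pw (.var .l)))
    (.loop .a (.var .c)
      (.setArr .acc (.add (.var .c) (.var .a))
        (.add (.arr .acc (.var .a)) (.arr .mark (.var .v))))))))))

/-- Read the sizes and compute the powers of two. -/
def readSizes : Cmd :=
  .seq (.set .n (.raw (.lit 0)))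
  (.seq (.set .T (.raw (.lit 1)))
  (.seq (.set .p (.add (.var .T) (.add (.var .T) (.var .T))))
  (.seq (.set .m (.raw (.add (.lit 2) (.var .p))))
  (.seq (.setArr .pw (.lit 0) (.lit 1))
  (.loop .j (.var .n)
    (.setArr .pw (.add (.var .j) (.lit 1))
      (.add (.arr .pw (.var .j)) (.arr .pw (.var .j)))))))))

/-- Compute the arrays `np`, `off` and `top`. -/
def readNodes : Cmd :=
  .seq (.set .ptr (.add (.lit 3) (.var .p)))
  (.seq (.set .o (.lit 0))
  (.loop .t (.var .m)
    (.seq (.setArr .np (.var .t) (.var .ptr))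
    (.seq (.setArr .off (.var .t) (.var .o))
    (.seq (.set .b (.raw (.add (.var .ptr) (.lit 1))))
    (.seq (.loop .l (.var .b)
      (.seq (.set .v (.raw (.add (.add (.var .ptr) (.lit 2)) (.var .l))))
        (.ifLt (.nat (.arr .top (.var .v))) (.nat (.lit 1))
          (.setArr .top (.var .v) (.add (.var .t) (.lit 1))) .skip)))
    (.seq (.set .ptr (.add (.var .ptr) (.add (.lit 2) (.var .b))))
      (.set .o (.add (.var .o) (.arr .pw (.var .b)))))))))))

/-- Add the `q`-th term to the table of its node. -/
def addTerm : Cmd :=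
  .seq (.set .p (.add (.lit 2) (.add (.add (.var .q) (.var .q)) (.var .q))))
  (.seq (.set .i (.raw (.var .p)))
  (.seq (.set .j (.raw (.add (.var .p) (.lit 1))))
  (.seq (.set .t (.sub (.arr .top (.var .i)) (.lit 1)))
  (.seq (.ifLt (.nat (.arr .top (.var .i))) (.nat (.arr .top (.var .j)))
    (.set .t (.sub (.arr .top (.var .j)) (.lit 1))) .skip)
  (.seq (.setArr .mark (.var .i) (.add (.arr .mark (.var .i)) (.lit 1)))
  (.seq (.setArr .mark (.var .j) (.add (.arr .mark (.var .j)) (.lit 1)))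
  (.seq (sums .t)
  (.seq (.set .o (.arr .off (.var .t)))
  (.seq (.loop .a (.arr .pw (.var .b))
    (.ifLt (.nat (.lit 1)) (.nat (.arr .acc (.var .a)))
      (.setTab (.add (.var .o) (.var .a)) (.add (.tab (.add (.var .o) (.var .a)))
        (.raw (.add (.var .p) (.lit 2))))) .skip))
  (.seq (.setArr .mark (.var .i) (.lit 0))
    (.setArr .mark (.var .j) (.lit 0))))))))))))

def addTerms : Cmd := .loop .q (.var .T) addTerm

/-- Mark the elements of the bag of `t` that occur above `t` with powers of two. -/
def markSep : Cmd :=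
  .loop .l (.var .b)
    (.seq (.set .v (.raw (.add (.add (.var .z) (.lit 2)) (.var .l))))
      (.ifLt (.nat (.arr .top (.var .v))) (.nat (.add (.var .t) (.lit 1)))
        (.setArr .mark (.var .v) (.arr .pw (.var .l))) .skip))

/-- For every assignment to the separator of `t`, compute an optimal extension to the bag. -/
def optimize : Cmd :=
  .seq (.loop .a (.arr .pw (.var .b)) (.setArr .arg (.add (.var .o) (.var .a)) (.var .a)))
    (.loop .a (.arr .pw (.var .b))
      (.ifLt (.tab (.add (.var .o) (.var .a)))
        (.tab (.add (.var .o) (.arr .arg (.add (.var .o) (.arr .acc (.var .a))))))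
        (.setArr .arg (.add (.var .o) (.arr .acc (.var .a))) (.var .a)) .skip))

/-- Add the optimal values for the separator of `t` to the table of the parent `p`. -/
def push : Cmd :=
  .loop .a (.arr .pw (.var .b))
    (.setTab (.add (.var .key) (.var .a)) (.add (.tab (.add (.var .key) (.var .a)))
      (.tab (.add (.var .o) (.arr .arg (.add (.var .o) (.arr .acc (.var .a))))))))

def unmark : Cmd :=
  .loop .l (.var .b)
    (.setArr .mark (.raw (.add (.add (.var .z) (.lit 2)) (.var .l))) (.lit 0))

def eliminateNode : Cmd :=
  .seq (.set .t (.sub (.var .m) (.add (.var .r) (.lit 1))))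
  (.seq (.set .z (.arr .np (.var .t)))
  (.seq (.set .b (.raw (.add (.var .z) (.lit 1))))
  (.seq (.set .o (.arr .off (.var .t)))
  (.seq markSep
  (.seq (sums .t)
  (.seq optimize
  (.seq (.set .p (.raw (.var .z)))
  (.seq (.set .key (.arr .off (.var .p)))
  (.seq (sums .p)
  (.seq push
  (.seq (.set .z (.arr .np (.var .t)))
  (.seq (.set .b (.raw (.add (.var .z) (.lit 1))))
    unmark))))))))))))

def eliminate : Cmd := .loop .r (.var .m) eliminateNode

/-- Extend the partial solution to the bag of `t`. -/
def decodeNode : Cmd :=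
  .seq (.set .z (.arr .np (.var .t)))
  (.seq (.set .b (.raw (.add (.var .z) (.lit 1))))
  (.seq (.set .o (.arr .off (.var .t)))
  (.seq (.set .key (.lit 0))
  (.seq (.loop .l (.var .b)
    (.ifLt (.nat (.lit 0)) (.nat (.arr .sol (.raw (.add (.add (.var .z) (.lit 2)) (.var .l)))))
      (.set .key (.add (.var .key) (.arr .pw (.var .l)))) .skip))
  (.seq (.set .best (.arr .arg (.add (.var .o) (.var .key))))
  (.seq (.set .cur (.lit 0))
  (.loop .l (.var .b)
    (.seq (.set .q (.sub (.var .b) (.add (.var .l) (.lit 1))))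
    (.seq (.set .v (.raw (.add (.add (.var .z) (.lit 2)) (.var .q))))
    (.ifLt (.nat (.var .best)) (.nat (.add (.var .cur) (.arr .pw (.var .q))))
      (.setArr .sol (.var .v) (.lit 0))
      (.seq (.setArr .sol (.var .v) (.lit 1))
        (.set .cur (.add (.var .cur) (.arr .pw (.var .q)))))))))))))))

def decode : Cmd := .loop .t (.var .m) decodeNode

def output : Cmd := .loop .j (.var .n) (.setRaw (.var .j) (.nat (.arr .sol (.var .j))))

def solve : Cmd :=
  .seq readSizes (.seq readNodes (.seq addTerms (.seq eliminate (.seq decode output))))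

/-! ### Correctness of the parts -/

/-- The store `s` contains the preprocessed input. -/
structure Static (I : Inst) (s : Store) : Prop where
  raw : s.raw = I.inp
  n : s.var .n = I.n
  T : s.var .T = I.T
  m : s.var .m = I.m
  pw : ∀ j ≤ I.n, s.arr .pw j = 2 ^ j
  np : ∀ t < I.m, s.arr .np t = I.np t
  off : ∀ t < I.m, s.arr .off t = I.off t
  top : ∀ v < I.n, s.arr .top v = I.top v + 1

def Cmd.keepsStatic (c : Cmd) : Bool :=
  !(c.writesRaw || c.writesVar .n || c.writesVar .T || c.writesVar .m || c.writesArr .pw ||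
    c.writesArr .np || c.writesArr .off || c.writesArr .top)

variable {I : Inst} {s s' : Store}

theorem Static.frame {c : Cmd} (h : Static I s) (hf : Frame c s s') (hc : c.keepsStatic = true) :
    Static I s' := by
  simp only [Cmd.keepsStatic, Bool.not_eq_true', Bool.or_eq_false_iff] at hc
  obtain ⟨⟨⟨⟨⟨⟨⟨h1, h2⟩, h3⟩, h4⟩, h5⟩, h6⟩, h7⟩, h8⟩ := hc
  refine ⟨(hf.raw h1).trans h.raw, (hf.var _ h2).trans h.n, (hf.var _ h3).trans h.T,
    (hf.var _ h4).trans h.m, ?_, ?_, ?_, ?_⟩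
  · rw [hf.arr _ h5]; exact h.pw
  · rw [hf.arr _ h6]; exact h.np
  · rw [hf.arr _ h7]; exact h.off
  · rw [hf.arr _ h8]; exact h.top

theorem Static.setVar (h : Static I s) {x : Var} (k : ℕ)
    (hx : (Cmd.set x (.lit k)).keepsStatic = true) : Static I (s.setVar x k) :=
  h.frame (Loop.frame (.set x (.lit k)) s) hx

theorem Static.setArr (h : Static I s) {A : Arr} (i k : ℕ)
    (hx : (Cmd.setArr A (.lit i) (.lit k)).keepsStatic = true) : Static I (s.setArr A i k) :=
  h.frame (Loop.frame (.setArr A (.lit i) (.lit k)) s) hx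

/-- The positions from `2 ^ l` to `2 ^ (l + 1) - 1` are the subsets of the first `l + 1` elements
that contain the last of them. Their sums arise from the first `2 ^ l` entries by adding one mark.
The passes form a geometric series, which avoids a factor equal to the bag size. -/
theorem triple_sums (hI : I.Valid) (hs : Static I s) {x : Var} {t : ℕ} (hx : s.var x = t)
    (ht : t < I.m) :
    Triple (sums x) s (10 * 2 ^ I.bl t) fun s' =>
      s'.var .z = I.np t ∧ s'.var .b = I.bl t ∧
      ∀ y, s'.arr .acc (I.idx t y) =
        ∑ l ∈ Finset.range (I.bl t), (y (I.bg t l)).toNat * s.arr .mark (I.bg t l) := by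
  have hz : NExp.eval s (.arr .np (.var x)) = I.np t := by simp [NExp.eval, hx, hs.np t ht]
  have key : Triple (sums x) s (1 + (1 + (1 + (1 + ∑ l ∈ Finset.range (I.bl t),
      (1 + (1 + (1 + (1 + 2 ^ l * (1 + 1))))))))) fun s' =>
      s'.var .z = I.np t ∧ s'.var .b = I.bl t ∧
      ∀ y, s'.arr .acc (binary (I.bl t) y) =
        ∑ l ∈ Finset.range (I.bl t), (y l).toNat * s.arr .mark (I.bg t l) := by
    refine Triple.set (Triple.set (Triple.setArr ?_))
    rw [hz]
    set S := Store.setArr _ _ _ _ with hS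
    have hSz : S.var .z = I.np t := by simp [hS, Store.setArr, Store.setVar]
    have hSb : S.var .b = I.bl t := by
      simp [hS, Store.setArr, Store.setVar, NExp.eval, hs.raw, hI.inp_bl t ht]
    have hSmark : S.arr .mark = s.arr .mark := by
      simp [hS, Store.setArr, Store.setVar]
    have hSs : Static I S := ((hs.setVar _ rfl).setVar _ rfl).setArr _ _ rfl
    have hS0 : S.arr .acc 0 = 0 := by simp [hS, Store.setArr, NExp.eval]
    clear_value S
    refine (Triple.loop (I.bl t) (by simpa [NExp.eval] using hSb) _
      (fun k s' => ∀ y, s'.arr .acc (binary k y) =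
        ∑ l ∈ Finset.range k, (y l).toNat * s.arr .mark (I.bg t l))
      (by simpa [binary] using hS0) ?_).mono le_rfl ?_
    · intro l hl s₁ hf hinv
      have hz₁ : s₁.var .z = I.np t := (hf.var _ rfl).trans hSz
      have hs₁ : Static I s₁ := hSs.frame hf rfl
      have hm₁ : s₁.arr .mark = s.arr .mark := (hf.arr _ rfl).trans hSmark
      refine Triple.set (Triple.set ?_)
      set R := Store.setVar _ .c _ with hR
      have hRv : R.var .v = I.bg t l := by
        simp [hR, Store.setVar, NExp.eval, hz₁, hs₁.raw, hI.inp_bg t ht l hl]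
      have hRc : R.var .c = 2 ^ l := by
        have := hI.bl_le t ht
        simp [hR, Store.setVar, NExp.eval, hs₁.pw l (by omega)]
      have hRa : R.arr = s₁.arr := rfl
      clear_value R
      refine (Triple.loop_const (2 ^ l) (by simpa [NExp.eval] using hRc) 1
        (fun k s' => (∀ i < 2 ^ l, s'.arr .acc i = s₁.arr .acc i) ∧
          ∀ i < k, s'.arr .acc (2 ^ l + i) = s₁.arr .acc i + s.arr .mark (I.bg t l))
        (by simp [hRa]) ?_).mono le_rfl ?_
      · intro k hk s₂ hf₂ ⟨h1, h2⟩
        have hm₂ : s₂.arr .mark = s.arr .mark := by rw [hf₂.arr _ rfl, hRa, hm₁]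
        have hc₂ : s₂.var .c = 2 ^ l := (hf₂.var _ rfl).trans hRc
        have hv₂ : s₂.var .v = I.bg t l := (hf₂.var _ rfl).trans hRv
        refine ⟨le_rfl, ?_, ?_⟩
        · intro i hi
          simp [Cmd.run, Store.setArr, Store.setVar, NExp.eval, hc₂,
            show i ≠ 2 ^ l + k by omega, h1 i hi]
        · intro i hi
          simp only [Cmd.run, Store.setArr, Store.setVar, NExp.eval, hc₂, hv₂, hm₂,
            Function.update_apply, if_true]
          simp only [reduceCtorEq, if_false]
          by_cases hik : i = k
          · simp [hik, h1 k hk]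
          · simp [hik, h2 i (by omega)]
      · intro s₃ _ ⟨h1, h2⟩ y
        rw [binary_succ, Finset.sum_range_succ, ← hinv y]
        have := binary_lt l y
        cases hy : y l
        · simpa using h1 _ this
        · simpa [add_comm] using h2 _ this
    · intro s₁ hf h
      exact ⟨(hf.var _ rfl).trans hSz, (hf.var _ rfl).trans hSb, h⟩
  refine key.mono ?_ fun s' _ h => ⟨h.1, h.2.1, fun y => h.2.2 _⟩
  -- The linear part `4 * b` of the cost is absorbed by the exponential; the constants make the case
  -- `b = 0` an equality.
  have h1 : ∀ b : ℕ, (∑ l ∈ Finset.range b, (1 + (1 + (1 + (1 + 2 ^ l * (1 + 1)))))) + 6 ≤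
      10 * 2 ^ b - 4 := by
    intro b
    induction b with
    | zero => simp
    | succ b ih =>
      rw [Finset.sum_range_succ, pow_succ]
      have := Nat.one_le_two_pow (n := b)
      omega
  have := h1 (I.bl t)
  omega

/-! ### Preprocessing of the input -/

theorem triple_readSizes (hI : I.Valid) (hs : s.raw = I.inp) :
    Triple readSizes s (6 + 2 * I.n) fun s' =>
      s'.var .n = I.n ∧ s'.var .T = I.T ∧ s'.var .m = I.m ∧ s'.var .p = I.T + I.T + I.T ∧
      ∀ j ≤ I.n, s'.arr .pw j = 2 ^ j := by
  have key : Triple readSizes s (1 + (1 + (1 + (1 + (1 + (1 + I.n * (1 + 1))))))) fun s' =>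
      s'.var .n = I.n ∧ s'.var .T = I.T ∧ s'.var .m = I.m ∧ s'.var .p = I.T + I.T + I.T ∧
      ∀ j ≤ I.n, s'.arr .pw j = 2 ^ j := by
    refine Triple.set (Triple.set (Triple.set (Triple.set (Triple.setArr ?_))))
    set S := Store.setArr _ _ _ _ with hS
    have hn : S.var .n = I.n := by
      simp [hS, Store.setArr, Store.setVar, NExp.eval, hs, hI.inp_n]
    have hT : S.var .T = I.T := by
      simp [hS, Store.setArr, Store.setVar, NExp.eval, hs, hI.inp_T]
    have hp : S.var .p = I.T + I.T + I.T := by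
      simp [hS, Store.setArr, Store.setVar, NExp.eval, hs, hI.inp_T, add_assoc]
    have hm : S.var .m = I.m := by
      have := hI.inp_m
      simp [hS, Store.setArr, Store.setVar, NExp.eval, hs, hI.inp_T, ← add_assoc] at this ⊢
      simp [this]
    have h0 : S.arr .pw 0 = 1 := by simp [hS, Store.setArr, NExp.eval]
    clear_value S
    refine (Triple.loop_const I.n (by simpa [NExp.eval] using hn) 1
      (fun k s' => ∀ j ≤ k, s'.arr .pw j = 2 ^ j) (by simpa using h0) ?_).mono le_rfl ?_
    · intro k hk s₁ hf h
      refine ⟨le_rfl, fun j hj => ?_⟩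
      by_cases hjk : j = k + 1
      · simp [Cmd.run, Store.setArr, Store.setVar, NExp.eval, hjk, h k le_rfl, pow_succ]; ring
      · simp [Cmd.run, Store.setArr, Store.setVar, NExp.eval, hjk, h j (by omega)]
    · intro s₁ hf h
      exact ⟨(hf.var _ rfl).trans hn, (hf.var _ rfl).trans hT, (hf.var _ rfl).trans hm,
        (hf.var _ rfl).trans hp, h⟩
  exact key.mono (by omega) fun _ _ h => h

/-- Nodes are visited in increasing order, so the first visited bag containing `v` belongs to `I.top
v`. The array stores this node plus one, and zero means that `v` has not been seen. -/
theorem triple_readNodes (hI : I.Valid) {W : ℕ} (hW : ∀ t < I.m, 2 ^ I.bl t ≤ W)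
    (hraw : s.raw = I.inp) (hn : s.var .n = I.n) (hT : s.var .T = I.T) (hm : s.var .m = I.m)
    (hp : s.var .p = I.T + I.T + I.T) (hpw : ∀ j ≤ I.n, s.arr .pw j = 2 ^ j)
    (htop : ∀ v, s.arr .top v = 0) :
    Triple readNodes s (3 + I.m * (7 + 4 * W)) (Static I) := by
  have key : Triple readNodes s (1 + (1 + (1 + I.m * (1 + (1 + (1 + (1 + ((1 + W * (1 + (1 + 2)))
      + (1 + 1))))))))) (Static I) := by
    refine Triple.set (Triple.set ?_)
    set S := Store.setVar _ .o _ with hS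
    have hSptr : S.var .ptr = I.np 0 := by
      simp [hS, Store.setVar, NExp.eval, hp, Inst.np]
    have hSo : S.var .o = 0 := by simp [hS, Store.setVar, NExp.eval]
    have hSn : S.var .n = I.n := by simp [hS, Store.setVar, hn]
    have hST : S.var .T = I.T := by simp [hS, Store.setVar, hT]
    have hSm : S.var .m = I.m := by simp [hS, Store.setVar, hm]
    have hSarr : S.arr = s.arr := rfl
    have hSraw : S.raw = I.inp := hraw
    clear_value S
    refine (Triple.loop_const I.m (by simpa [NExp.eval] using hSm) _
      (fun k s' => s'.var .ptr = I.np k ∧ s'.var .o = I.off k ∧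
        (∀ t < k, s'.arr .np t = I.np t) ∧ (∀ t < k, s'.arr .off t = I.off t) ∧
        ∀ v < I.n, s'.arr .top v = if I.top v < k then I.top v + 1 else 0)
      (by simp [hSptr, hSo, hSarr, htop, Inst.off]) ?_).mono le_rfl ?_
    · intro t ht s₁ hf ⟨h1, h2, h3, h4, h5⟩
      have hraw₁ : s₁.raw = I.inp := (hf.raw rfl).trans hSraw
      have hpw₁ : s₁.arr .pw (I.bl t) = 2 ^ I.bl t := by
        rw [hf.arr _ rfl, hSarr]
        exact hpw _ (hI.bl_le t ht)
      refine Triple.setArr (Triple.setArr (Triple.set ?_))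
      set R := Store.setVar _ .b _ with hR
      have hRt : R.var .t = t := by simp [hR, Store.setVar, Store.setArr]
      have hRptr : R.var .ptr = I.np t := by simp [hR, Store.setVar, Store.setArr, h1]
      have hRo : R.var .o = I.off t := by simp [hR, Store.setVar, Store.setArr, h2]
      have hRb : R.var .b = I.bl t := by
        simp [hR, Store.setVar, Store.setArr, NExp.eval, h1, hraw₁, hI.inp_bl t ht]
      have hRnp : ∀ u < t + 1, R.arr .np u = I.np u := by
        intro u hu
        by_cases hut : u = t
        · simp [hR, Store.setVar, Store.setArr, NExp.eval, h1, hut]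
        · simp [hR, Store.setVar, Store.setArr, NExp.eval, hut, h3 u (by omega)]
      have hRoff : ∀ u < t + 1, R.arr .off u = I.off u := by
        intro u hu
        by_cases hut : u = t
        · simp [hR, Store.setVar, Store.setArr, NExp.eval, h2, hut]
        · simp [hR, Store.setVar, Store.setArr, NExp.eval, hut, h4 u (by omega)]
      have hRtop : R.arr .top = s₁.arr .top := by
        simp [hR, Store.setVar, Store.setArr]
      have hRpw : R.arr .pw = s₁.arr .pw := by
        simp [hR, Store.setVar, Store.setArr]
      have hRraw : R.raw = I.inp := hraw₁
      clear_value R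
      refine Triple.seq (R := fun s' => ∀ v < I.n, s'.arr .top v =
          if I.top v < t + 1 then I.top v + 1 else 0) ?_ ?_
      · refine (Triple.loop_const (I.bl t) (by simpa [NExp.eval] using hRb) (1 + 2)
          (fun k s' => ∀ v < I.n, s'.arr .top v =
            if I.top v < t ∨ ∃ l < k, I.bg t l = v then I.top v + 1 else 0)
          ?_ ?_).mono ?_ ?_
        · intro v hv
          simp [hRtop, h5 v hv]
        · intro l hl s₂ hf₂ h
          have hptr₂ : s₂.var .ptr = I.np t := (hf₂.var _ rfl).trans hRptr
          have ht₂ : s₂.var .t = t := (hf₂.var _ rfl).trans hRt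
          have hraw₂ : s₂.raw = I.inp := (hf₂.raw rfl).trans hRraw
          refine Triple.set ?_
          set V := Store.setVar _ .v _ with hV
          have hVv : V.var .v = I.bg t l := by
            simp [hV, Store.setVar, NExp.eval, hptr₂, hraw₂, hI.inp_bg t ht l hl]
          have hVt : V.var .t = t := by simp [hV, Store.setVar, ht₂]
          have hVtop : V.arr .top = s₂.arr .top := rfl
          clear_value V
          have hbl := hI.bg_lt t ht l hl
          have htl := hI.top_le t ht _ ⟨l, hl, rfl⟩
          have step : ∀ v, (I.top v < t ∨ ∃ l' < l + 1, I.bg t l' = v) ↔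
              ((I.top v < t ∨ ∃ l' < l, I.bg t l' = v) ∨ v = I.bg t l) := by
            intro v
            simp only [Nat.lt_succ_iff_lt_or_eq, or_and_right, exists_or, exists_eq_left, or_assoc,
              eq_comm (a := v)]
          refine ⟨?_, fun v hv => ?_⟩
          · simp only [Cmd.cost, cost_skip]; split_ifs <;> omega
          · simp only [Cmd.run, IExp.eval, NExp.eval, hVv, hVtop, h _ hbl, run_skip, step]
            by_cases hc : I.top (I.bg t l) < t ∨ ∃ l' < l, I.bg t l' = I.bg t l
            · rw [if_neg (by simp [hc])]
              rw [hVtop, h v hv]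
              by_cases hvl : v = I.bg t l
              · subst hvl; simp [hc]
              · simp [hvl]
            · rw [if_pos (by simp [hc])]
              have : I.top (I.bg t l) = t := by
                rw [not_or] at hc; omega
              by_cases hvl : v = I.bg t l
              · subst hvl
                simp [Store.setArr, hVt, this]
              · simp [Store.setArr, hVt, hvl, hVtop, h v hv]
        · have := hW t ht
          have h6 : I.bl t ≤ W := Nat.lt_two_pow_self.le.trans this
          exact Nat.add_le_add_left (Nat.mul_le_mul_right _ h6) 1
        · intro s₂ hf₂ h v hv
          rw [h v hv]
          congr 1
          rw [eq_iff_iff, Nat.lt_succ_iff_lt_or_eq]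
          constructor
          · rintro (h | ⟨l, hl, rfl⟩)
            · exact .inl h
            · exact Nat.lt_succ_iff_lt_or_eq.mp (Nat.lt_succ_iff.mpr (hI.top_le t ht _ ⟨l, hl, rfl⟩))
          · rintro (h | h)
            · exact .inl h
            · exact .inr (h ▸ hI.top_mem v hv)
      · intro s₂ hf₂ htop₂
        have e1 : s₂.var .ptr = I.np t := (hf₂.var _ rfl).trans hRptr
        have e2 : s₂.var .o = I.off t := (hf₂.var _ rfl).trans hRo
        have e3 : s₂.var .b = I.bl t := (hf₂.var _ rfl).trans hRb
        have e4 : s₂.arr .pw (I.bl t) = 2 ^ I.bl t := by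
          rw [hf₂.arr _ rfl, hRpw, hpw₁]
        refine ⟨le_rfl, ?_, ?_, ?_, ?_, ?_⟩
        · simp [Cmd.run, Store.setVar, NExp.eval, e1, e3, Inst.np_succ]
        · simp [Cmd.run, Store.setVar, NExp.eval, e2, e3, e4, Inst.off_succ]
        · intro u hu
          exact (congrFun (hf₂.arr .np rfl) u).trans (hRnp u hu)
        · intro u hu
          exact (congrFun (hf₂.arr .off rfl) u).trans (hRoff u hu)
        · exact htop₂
    · intro s₁ hf ⟨_, _, h3, h4, h5⟩
      refine ⟨(hf.raw rfl).trans hSraw, (hf.var _ rfl).trans hSn, (hf.var _ rfl).trans hST,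
        (hf.var _ rfl).trans hSm, ?_, h3, h4, fun v hv => ?_⟩
      · rw [hf.arr _ rfl, hSarr]; exact hpw
      · rw [h5 v hv, if_pos (hI.top_lt v hv)]
  refine key.mono (le_of_eq ?_) fun _ _ h => h
  ring

/-! ### Filling the tables -/

theorem _root_.Inst.Valid.node_lt (hI : I.Valid) {q : ℕ} (hq : q < I.T) : I.node q < I.m :=
  max_lt (hI.top_lt _ (hI.ti_lt q hq)) (hI.top_lt _ (hI.tj_lt q hq))

theorem sum_bag_pair (hI : I.Valid) {t i j : ℕ} (ht : t < I.m) (hi : I.Mem t i) (hj : I.Mem t j)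
    (hin : i < I.n) (hjn : j < I.n) (x : ℕ → Bool) :
    ∑ l ∈ Finset.range (I.bl t), (x (I.bg t l)).toNat *
      ((if I.bg t l = i then 1 else 0) + (if I.bg t l = j then 1 else 0)) =
      (x i).toNat + (x j).toNat := by
  rw [hI.sum_bag ht
    (fun v => (x v).toNat * ((if v = i then 1 else 0) + (if v = j then 1 else 0)))]
  · simp [mul_add, Finset.sum_add_distrib, hin, hjn]
  · intro v hv
    by_contra hc
    have h1 : v ≠ i := by rintro rfl; exact hc hi
    have h2 : v ≠ j := by rintro rfl; exact hc hj
    simp [h1, h2] at hv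

/-- The marks of the two variables are added, so a linear term puts the mark 2 on its only variable.
For linear and quadratic terms alike, the monomial equals 1 exactly when the sum of marks exceeds 1.
-/
theorem triple_addTerm (hI : I.Valid) {W : ℕ} (hW : ∀ t < I.m, 2 ^ I.bl t ≤ W)
    (hs : Static I s) (hmark : ∀ v, s.arr .mark v = 0) {q : ℕ} (hq : q < I.T)
    (hsq : s.var .q = q) :
    Triple addTerm s (12 + 13 * W) fun s' => (∀ v, s'.arr .mark v = 0) ∧
      ∀ t < I.m, ∀ x, s'.tab (I.off t + I.idx t x) = s.tab (I.off t + I.idx t x) +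
        if I.node q = t then (if x (I.ti q) && x (I.tj q) then I.wt q else 0) else 0 := by
  have key : Triple addTerm s (1 + (1 + (1 + (1 + (2 + (1 + (1 + (10 * 2 ^ I.bl (I.node q) +
      (1 + ((1 + 2 ^ I.bl (I.node q) * (1 + 2)) + (1 + 1))))))))))) fun s' =>
      (∀ v, s'.arr .mark v = 0) ∧
      ∀ t < I.m, ∀ x, s'.tab (I.off t + I.idx t x) = s.tab (I.off t + I.idx t x) +
        if I.node q = t then (if x (I.ti q) && x (I.tj q) then I.wt q else 0) else 0 := by
    have hnode := hI.node_lt hq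
    refine Triple.set (Triple.set (Triple.set (Triple.set ?_)))
    set S := Store.setVar _ .t _ with hS
    have hp : S.var .p = 2 + (q + q + q) := by
      simp [hS, Store.setVar, NExp.eval, hsq]
    have hi : S.var .i = I.ti q := by
      simp [hS, Store.setVar, NExp.eval, hsq, hs.raw, hI.inp_ti q hq]
    have hj : S.var .j = I.tj q := by
      simp [hS, Store.setVar, NExp.eval, hsq, hs.raw, hI.inp_tj q hq]
    have ht : S.var .t = I.top (I.ti q) := by
      simp [hS, Store.setVar, NExp.eval, hsq, hs.raw, hI.inp_ti q hq, hs.top _ (hI.ti_lt q hq)]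
    have hSs : Static I S :=
      (((hs.setVar _ rfl).setVar _ rfl).setVar _ rfl).setVar _ rfl
    have hSmark : S.arr .mark = s.arr .mark := rfl
    have hStab : S.tab = s.tab := rfl
    clear_value S
    have hti := hSs.top _ (hI.ti_lt q hq)
    have htj := hSs.top _ (hI.tj_lt q hq)
    refine Triple.seq (R := fun s' => s'.var .t = I.node q ∧ s'.var .p = S.var .p ∧
      s'.var .i = S.var .i ∧ s'.var .j = S.var .j) ?_ ?_
    · refine ⟨?_, ?_⟩
      · simp only [Cmd.cost, cost_skip]; split_ifs <;> omega
      · simp only [Cmd.run, IExp.eval, NExp.eval, hi, hj, hti, htj, run_skip, Nat.cast_lt]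
        split_ifs with hlt
        · simp [Store.setVar, hi, hj, Inst.node]; omega
        · simp [ht, hi, hj, Inst.node]; omega
    · intro s₁ hf₁ ⟨ht₁, hp₁, hi₁, hj₁⟩
      rw [hp] at hp₁
      rw [hi] at hi₁
      rw [hj] at hj₁
      have hs₁ := hSs.frame hf₁ rfl
      have hmark₁ : ∀ v, s₁.arr .mark v = 0 := by
        intro v; rw [hf₁.arr _ rfl, hSmark, hmark]
      have htab₁ : s₁.tab = s.tab := (hf₁.tab rfl).trans hStab
      refine Triple.setArr (Triple.setArr ?_)
      set R := Store.setArr (Store.setArr _ _ _ _) _ _ _ with hR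
      have hRs : Static I R := (hs₁.setArr _ _ rfl).setArr _ _ rfl
      have hRvar : R.var = s₁.var := rfl
      have hRtab : R.tab = s.tab := htab₁
      have hRmark : ∀ v, R.arr .mark v =
          (if v = I.ti q then 1 else 0) + (if v = I.tj q then 1 else 0) := by
        intro v
        simp only [hR, Store.setArr, NExp.eval, hi₁, hj₁, Function.update_self,
          Function.update_apply, hmark₁]
        split_ifs <;> simp_all
      clear_value R
      have hRt : R.var .t = I.node q := by rw [hRvar, ht₁]
      have hRi : R.var .i = I.ti q := by rw [hRvar, hi₁]
      have hRj : R.var .j = I.tj q := by rw [hRvar, hj₁]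
      have hRp : R.var .p = 2 + (q + q + q) := by rw [hRvar, hp₁]
      clear hRvar hR
      refine Triple.seq (triple_sums hI hRs hRt hnode) ?_
      intro s₂ hf₂ ⟨_, hb₂, hacc⟩
      have hs₂ := hRs.frame hf₂ rfl
      have hacc₂ : ∀ y, s₂.arr .acc (I.idx (I.node q) y) = (y (I.ti q)).toNat + (y (I.tj q)).toNat := by
        intro y
        rw [hacc]
        simp only [hRmark]
        exact sum_bag_pair hI hnode (hI.ti_mem q hq) (hI.tj_mem q hq) (hI.ti_lt q hq)
          (hI.tj_lt q hq) y
      have ht₂ : s₂.var .t = I.node q := (hf₂.var _ rfl).trans hRt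
      have hi₂ : s₂.var .i = I.ti q := (hf₂.var _ rfl).trans hRi
      have hj₂ : s₂.var .j = I.tj q := (hf₂.var _ rfl).trans hRj
      have hp₂ : s₂.var .p = 2 + (q + q + q) := (hf₂.var _ rfl).trans hRp
      have htab₂ : s₂.tab = s.tab := (hf₂.tab rfl).trans hRtab
      have hmark₂ : ∀ v, s₂.arr .mark v =
          (if v = I.ti q then 1 else 0) + (if v = I.tj q then 1 else 0) := by
        intro v; rw [hf₂.arr _ rfl, hRmark]
      refine Triple.set ?_
      set U := Store.setVar _ .o _ with hU
      have hUs : Static I U := hs₂.setVar _ rfl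
      have hUo : U.var .o = I.off (I.node q) := by
        simp [hU, Store.setVar, NExp.eval, ht₂, hs₂.off _ hnode]
      have hUb : U.var .b = I.bl (I.node q) := by simp [hU, Store.setVar, hb₂]
      have hUi : U.var .i = I.ti q := by simp [hU, Store.setVar, hi₂]
      have hUj : U.var .j = I.tj q := by simp [hU, Store.setVar, hj₂]
      have hUp : U.var .p = 2 + (q + q + q) := by simp [hU, Store.setVar, hp₂]
      have hUarr : U.arr = s₂.arr := rfl
      have hUtab : U.tab = s.tab := htab₂
      clear_value U
      refine Triple.seq (R := fun s' => ∀ t < I.m, ∀ x, s'.tab (I.off t + I.idx t x) =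
        s.tab (I.off t + I.idx t x) +
          if I.node q = t then (if x (I.ti q) && x (I.tj q) then I.wt q else 0) else 0) ?_ ?_
      · refine (Triple.loop_const (2 ^ I.bl (I.node q)) ?_ 2 (fun k s' => ∀ t < I.m, ∀ x,
          s'.tab (I.off t + I.idx t x) = s.tab (I.off t + I.idx t x) +
          if I.node q = t ∧ I.idx t x < k then
            (if x (I.ti q) && x (I.tj q) then I.wt q else 0) else 0) ?_ ?_).mono le_rfl ?_
        · simp [NExp.eval, hUb, hUs.pw _ (hI.bl_le _ hnode)]
        · simp [hUtab]
        · intro k hk s₃ hf₃ h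
          -- The current position is read as an assignment `y`, to which the formula for `acc`
          -- applies.
          obtain ⟨y, rfl⟩ := hI.exists_idx_eq hnode hk
          have ho₃ : s₃.var .o = I.off (I.node q) := (hf₃.var _ rfl).trans hUo
          have hp₃ : s₃.var .p = 2 + (q + q + q) := (hf₃.var _ rfl).trans hUp
          have hacc₃ : s₃.arr .acc = s₂.arr .acc := by rw [hf₃.arr _ rfl, hUarr]
          have hraw₃ : s₃.raw = I.inp := (hf₃.raw rfl).trans hUs.raw
          have hcond : (1 < s₃.arr .acc (I.idx (I.node q) y)) ↔
              (y (I.ti q) && y (I.tj q)) = true := by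
            rw [hacc₃, hacc₂]
            cases y (I.ti q) <;> cases y (I.tj q) <;> simp
          refine ⟨?_, fun t ht x => ?_⟩
          · simp only [Cmd.cost, cost_skip]; split_ifs <;> omega
          · have e1 : (Store.setVar s₃ .a (I.idx (I.node q) y)).arr = s₃.arr := rfl
            have e2 : (Store.setVar s₃ .a (I.idx (I.node q) y)).tab = s₃.tab := rfl
            have e3 : (Store.setVar s₃ .a (I.idx (I.node q) y)).raw = I.inp := hraw₃
            have e4 : (Store.setVar s₃ .a (I.idx (I.node q) y)).var .a = I.idx (I.node q) y := by
              simp [Store.setVar]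
            have e5 : (Store.setVar s₃ .a (I.idx (I.node q) y)).var .o = I.off (I.node q) := by
              simp [Store.setVar, ho₃]
            have e6 : (Store.setVar s₃ .a (I.idx (I.node q) y)).var .p = 2 + (q + q + q) := by
              simp [Store.setVar, hp₃]
            have hx := h t ht x
            simp only [Cmd.run, IExp.eval, NExp.eval, e1, e2, e3, e4, e5, e6, run_skip, Nat.cast_lt,
              hcond]
            by_cases hcase : I.node q = t ∧ I.idx t x = I.idx (I.node q) y
            · obtain ⟨rfl, hxy⟩ := hcase
              have hxi := Inst.eq_of_idx_eq hxy (hI.ti_mem q hq)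
              have hxj := Inst.eq_of_idx_eq hxy (hI.tj_mem q hq)
              rw [hxi, hxj] at hx ⊢
              rw [hxy] at hx ⊢
              simp only [lt_irrefl, and_false, if_false, add_zero, Nat.lt_succ_self, and_self,
                if_true] at hx ⊢
              split_ifs with hc
              · simp [Store.setTab, e2, hx, hI.inp_wt q hq]
              · simp [e2, hx]
            · have hne : I.off t + I.idx t x ≠ I.off (I.node q) + I.idx (I.node q) y := by
                rw [Ne, Inst.off_add_eq (Inst.idx_lt _ _) (Inst.idx_lt _ _)]
                rintro ⟨rfl, h⟩
                exact hcase ⟨rfl, h⟩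
              have : (I.node q = t ∧ I.idx t x < I.idx (I.node q) y + 1) ↔
                  (I.node q = t ∧ I.idx t x < I.idx (I.node q) y) := by
                constructor
                · rintro ⟨h1, h2⟩
                  exact ⟨h1, lt_of_le_of_ne (Nat.lt_succ_iff.mp h2) fun h => hcase ⟨h1, h⟩⟩
                · rintro ⟨h1, h2⟩; exact ⟨h1, by omega⟩
              simp only [this]
              split_ifs at hx ⊢ <;> simp [Store.setTab, e2, hne, hx]
        · intro s₃ _ h t ht x
          rw [h t ht x]
          congr 2
          rw [eq_iff_iff]
          exact ⟨fun h => h.1, fun h => ⟨h, h ▸ Inst.idx_lt _ _⟩⟩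
      · intro s₃ hf₃ htab₃
        have hi₃ : s₃.var .i = I.ti q := (hf₃.var _ rfl).trans hUi
        have hj₃ : s₃.var .j = I.tj q := (hf₃.var _ rfl).trans hUj
        have hmark₃ : s₃.arr .mark = s₂.arr .mark := by rw [hf₃.arr _ rfl, hUarr]
        refine ⟨le_rfl, fun v => ?_, htab₃⟩
        simp only [Cmd.run, Store.setArr, NExp.eval, hi₃, hj₃, Function.update_self,
          Function.update_apply, hmark₃, hmark₂]
        split_ifs <;> simp_all
  refine key.mono ?_ fun _ _ h => h
  have := hW _ (hI.node_lt hq)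
  omega

theorem triple_addTerms (hI : I.Valid) {W : ℕ} (hW : ∀ t < I.m, 2 ^ I.bl t ≤ W)
    (hs : Static I s) (hmark : ∀ v, s.arr .mark v = 0) (htab : ∀ i, s.tab i = 0) :
    Triple addTerms s (1 + I.T * (1 + (12 + 13 * W))) fun s' => (∀ v, s'.arr .mark v = 0) ∧
      ∀ t < I.m, ∀ x, s'.tab (I.off t + I.idx t x) = ∑ q ∈ Finset.range I.T,
        if I.node q = t then (if x (I.ti q) && x (I.tj q) then I.wt q else 0) else 0 := by
  refine Triple.loop_const I.T (by simpa [NExp.eval] using hs.T) _ (fun k s' =>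
    (∀ v, s'.arr .mark v = 0) ∧
      ∀ t < I.m, ∀ x, s'.tab (I.off t + I.idx t x) = ∑ q ∈ Finset.range k,
        if I.node q = t then (if x (I.ti q) && x (I.tj q) then I.wt q else 0) else 0)
    ⟨hmark, by simp [htab]⟩ ?_
  intro q hq s₁ hf ⟨hm, ht⟩
  refine (triple_addTerm hI hW ((hs.frame hf rfl).setVar q rfl) hm hq
    (by simp [Store.setVar])).mono le_rfl fun s₂ _ h => ⟨h.1, fun t htm x => ?_⟩
  rw [h.2 t htm x, Finset.sum_range_succ, ← ht t htm x]
  rfl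

/-- Each term is counted at exactly one node. -/
theorem energy_eq_sum_tables (hI : I.Valid) (x : ℕ → Bool) :
    I.energy x = ∑ t ∈ Finset.range I.m, ∑ q ∈ Finset.range I.T,
      if I.node q = t then (if x (I.ti q) && x (I.tj q) then I.wt q else 0) else 0 := by
  rw [Finset.sum_comm]
  refine Finset.sum_congr rfl fun q hq => ?_
  rw [Finset.sum_ite_eq]
  exact (if_pos (Finset.mem_range.mpr (hI.node_lt (Finset.mem_range.mp hq)))).symm

/-! ### Eliminating a node -/

/-- Subset sums of these marks are the positions `sep`. The second conclusion confines the marks to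
the separator, so the same marks can be summed over the parent's bag and later erased through the
bag of `t`. -/
theorem triple_markSep (hI : I.Valid) (hs : Static I s) {t : ℕ} (ht : t < I.m)
    (hst : s.var .t = t) (hz : s.var .z = I.np t) (hb : s.var .b = I.bl t)
    (hmark : ∀ v, s.arr .mark v = 0) :
    Triple markSep s (1 + I.bl t * (1 + (1 + 2))) fun s' =>
      (∀ l < I.bl t, s'.arr .mark (I.bg t l) = if I.top (I.bg t l) < t then 2 ^ l else 0) ∧
      ∀ v, s'.arr .mark v ≠ 0 → I.Mem t v ∧ I.top v < t := by
  refine (Triple.loop_const (I.bl t) (by simpa [NExp.eval] using hb) (1 + 2) (fun k s' =>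
      (∀ l < k, s'.arr .mark (I.bg t l) = if I.top (I.bg t l) < t then 2 ^ l else 0) ∧
      ∀ v, s'.arr .mark v ≠ 0 → (∃ l < k, I.bg t l = v) ∧ I.top v < t) (by simp [hmark])
      ?_).mono le_rfl fun _ _ h => h
  intro k hk s₁ hf ⟨h1, h2⟩
  have hs₁ := hs.frame hf rfl
  have hz₁ : s₁.var .z = I.np t := (hf.var _ rfl).trans hz
  have ht₁ : s₁.var .t = t := (hf.var _ rfl).trans hst
  refine Triple.set ?_
  set S := Store.setVar _ .v _ with hS
  have hSv : S.var .v = I.bg t k := by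
    simp [hS, Store.setVar, NExp.eval, hz₁, hs₁.raw, hI.inp_bg t ht k hk]
  have hSl : S.var .l = k := by simp [hS, Store.setVar]
  have hSt : S.var .t = t := by simp [hS, Store.setVar, ht₁]
  have hSs : Static I S := (hs₁.setVar _ rfl).setVar _ rfl
  have hSarr : S.arr = s₁.arr := rfl
  clear_value S
  have hzero : ∀ l < k, I.bg t l ≠ I.bg t k := by
    intro l hl h
    exact hl.ne (hI.bg_inj t ht l (by omega) k hk h)
  have hsk : s₁.arr .mark (I.bg t k) = 0 := by
    by_contra h
    obtain ⟨⟨l, hl, h⟩, _⟩ := h2 _ h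
    exact hzero l hl h
  refine ⟨?_, ?_, ?_⟩
  · simp only [Cmd.cost, cost_skip]; split_ifs <;> omega
  · intro l hl
    simp only [Cmd.run, IExp.eval, NExp.eval, hSv, hSt, hSl, hSs.top _ (hI.bg_lt t ht k hk),
      run_skip, Nat.cast_lt, Nat.add_lt_add_iff_right,
      hSs.pw k (hk.le.trans (hI.bl_le t ht))]
    rcases Nat.lt_succ_iff_lt_or_eq.mp hl with hl | rfl
    · rw [← h1 l hl]
      split_ifs <;> simp [Store.setArr, hSarr, hzero l hl]
    · split_ifs <;> simp [Store.setArr, hSarr, hsk]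
  · intro v hv
    simp only [Cmd.run, IExp.eval, NExp.eval, hSv, hSt, hSl, hSs.top _ (hI.bg_lt t ht k hk),
      run_skip, Nat.cast_lt, Nat.add_lt_add_iff_right] at hv
    by_cases hvk : v = I.bg t k
    · subst hvk
      split_ifs at hv with hc
      · exact ⟨⟨k, by omega, rfl⟩, hc⟩
      · rw [hSarr] at hv; exact absurd hsk hv
    · have : s₁.arr .mark v ≠ 0 := by
        split_ifs at hv <;> simpa [Store.setArr, hSarr, hvk] using hv
      obtain ⟨⟨l, hl, h⟩, h'⟩ := h2 v this
      exact ⟨⟨l, by omega, h⟩, h'⟩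

theorem triple_unmark (hI : I.Valid) (hs : Static I s) {t : ℕ} (ht : t < I.m)
    (hz : s.var .z = I.np t) (hb : s.var .b = I.bl t)
    (hmark : ∀ v, s.arr .mark v ≠ 0 → I.Mem t v) :
    Triple unmark s (1 + I.bl t * (1 + 1)) fun s' => ∀ v, s'.arr .mark v = 0 := by
  refine (Triple.loop_const (I.bl t) (by simpa [NExp.eval] using hb) 1 (fun k s' =>
      ∀ v, s'.arr .mark v ≠ 0 → ∃ l < I.bl t, k ≤ l ∧ I.bg t l = v) ?_ ?_).mono le_rfl ?_
  · intro v hv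
    obtain ⟨l, hl, h⟩ := hmark v hv
    exact ⟨l, hl, Nat.zero_le _, h⟩
  · intro k hk s₁ hf h
    refine ⟨le_rfl, fun v hv => ?_⟩
    have hz₁ : s₁.var .z = I.np t := (hf.var _ rfl).trans hz
    have hr₁ : s₁.raw = I.inp := (hf.raw rfl).trans hs.raw
    have e : (Store.setVar s₁ .l k).raw = I.inp := hr₁
    have e' : (Store.setVar s₁ .l k).var .l = k := by simp [Store.setVar]
    have e'' : (Store.setVar s₁ .l k).var .z = I.np t := by simp [Store.setVar, hz₁]
    simp only [Cmd.run, NExp.eval, e, e', e'', hI.inp_bg t ht k hk, Int.toNat_natCast] at hv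
    by_cases hvk : v = I.bg t k
    · simp [Store.setArr, hvk] at hv
    · obtain ⟨l, hl, hkl, rfl⟩ := h v (by simpa [Store.setArr, hvk, Store.setVar] using hv)
      refine ⟨l, hl, ?_, rfl⟩
      rcases hkl.lt_or_eq with h | rfl
      · exact h
      · exact absurd rfl hvk
  · intro s₁ _ h v
    by_contra hv
    obtain ⟨l, hl, hl', _⟩ := h v hv
    omega

/-- For each separator assignment the scan keeps a candidate that extends it and is best among the
positions already visited. The last conclusion protects the choices recorded for nodes with larger
numbers. -/
theorem triple_optimize (hI : I.Valid) (hs : Static I s) {t : ℕ} (ht : t < I.m)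
    (ho : s.var .o = I.off t) (hb : s.var .b = I.bl t)
    (hacc : ∀ y, s.arr .acc (I.idx t y) = I.sep t y) :
    Triple optimize s ((1 + 2 ^ I.bl t * (1 + 1)) + (1 + 2 ^ I.bl t * (1 + 2))) fun s' =>
      (∀ x, ∃ y, s'.arr .arg (I.off t + I.sep t x) = I.idx t y ∧ I.sep t y = I.sep t x ∧
        ∀ z, I.sep t z = I.sep t x →
          s.tab (I.off t + I.idx t y) ≤ s.tab (I.off t + I.idx t z)) ∧
      ∀ i, I.off (t + 1) ≤ i → s'.arr .arg i = s.arr .arg i := by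
  have hpw := hs.pw _ (hI.bl_le t ht)
  refine Triple.seq (R := fun s' => (∀ i < 2 ^ I.bl t, s'.arr .arg (I.off t + i) = i) ∧
    ∀ i, I.off (t + 1) ≤ i → s'.arr .arg i = s.arr .arg i) ?_ ?_
  · refine Triple.loop_const (2 ^ I.bl t) (by simp [NExp.eval, hb, hpw]) 1 (fun k s' =>
      (∀ i < k, s'.arr .arg (I.off t + i) = i) ∧
      ∀ i, I.off (t + 1) ≤ i → s'.arr .arg i = s.arr .arg i) (by simp) ?_
    intro k hk s₁ hf ⟨h1, h2⟩
    have ho₁ : s₁.var .o = I.off t := (hf.var _ rfl).trans ho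
    refine ⟨le_rfl, fun i hi => ?_, fun i hi => ?_⟩
    · by_cases hik : i = k
      · simp [Cmd.run, Store.setArr, Store.setVar, NExp.eval, ho₁, hik]
      · simp [Cmd.run, Store.setArr, Store.setVar, NExp.eval, ho₁, hik, h1 i (by omega)]
    · rw [Inst.off_succ] at hi
      have : i ≠ I.off t + k := by omega
      simp [Cmd.run, Store.setArr, Store.setVar, NExp.eval, ho₁, this,
        h2 i (by rwa [Inst.off_succ])]
  · intro s₁ hf₁ ⟨h1, h2⟩
    have ho₁ : s₁.var .o = I.off t := (hf₁.var _ rfl).trans ho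
    have hb₁ : s₁.var .b = I.bl t := (hf₁.var _ rfl).trans hb
    have hpw₁ : s₁.arr .pw (I.bl t) = 2 ^ I.bl t := by rw [hf₁.arr _ rfl, hpw]
    have hacc₁ : s₁.arr .acc = s.arr .acc := hf₁.arr _ rfl
    have htab₁ : s₁.tab = s.tab := hf₁.tab rfl
    refine (Triple.loop_const (2 ^ I.bl t) (by simp [NExp.eval, hb₁, hpw₁]) 2 (fun k s' =>
      (∀ x, ∃ y, s'.arr .arg (I.off t + I.sep t x) = I.idx t y ∧ I.sep t y = I.sep t x ∧
        ∀ z, I.idx t z < k → I.sep t z = I.sep t x →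
          s.tab (I.off t + I.idx t y) ≤ s.tab (I.off t + I.idx t z)) ∧
      ∀ i, I.off (t + 1) ≤ i → s'.arr .arg i = s.arr .arg i) ?_ ?_).mono le_rfl ?_
    -- The initial candidate is the extension by `false`: its position in the table of `t` is the
    -- separator position itself, which the first loop stored there.
    · refine ⟨fun x => ⟨fun v => decide (I.top v < t) && x v, ?_, ?_, by simp⟩, h2⟩
      · rw [h1 _ (Inst.sep_lt _ _)]; rfl
      · exact Inst.sep_congr fun v _ hv => by simp [hv]
    · intro k hk s₂ hf₂ ⟨h3, h4⟩
      obtain ⟨w, rfl⟩ := hI.exists_idx_eq ht hk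
      obtain ⟨y₁, hy₁, hsep₁, hmin₁⟩ := h3 w
      have ho₂ : s₂.var .o = I.off t := (hf₂.var _ rfl).trans ho₁
      have hacc₂ : s₂.arr .acc = s.arr .acc := (hf₂.arr _ rfl).trans hacc₁
      have htab₂ : s₂.tab = s.tab := (hf₂.tab rfl).trans htab₁
      have e1 : (Store.setVar s₂ .a (I.idx t w)).arr = s₂.arr := rfl
      have e2 : (Store.setVar s₂ .a (I.idx t w)).tab = s.tab := htab₂
      have e3 : (Store.setVar s₂ .a (I.idx t w)).var .a = I.idx t w := by simp [Store.setVar]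
      have e4 : (Store.setVar s₂ .a (I.idx t w)).var .o = I.off t := by simp [Store.setVar, ho₂]
      refine ⟨?_, ?_⟩
      · simp only [Cmd.cost, cost_skip]; split_ifs <;> omega
      · simp only [Cmd.run, IExp.eval, NExp.eval, e1, e2, e3, e4, hacc₂, hacc, hy₁, run_skip]
        refine ⟨fun x => ?_, fun i hi => ?_⟩
        · by_cases hx : I.sep t x = I.sep t w
          · rw [hx]
            split_ifs with hlt
            · refine ⟨w, by simp [Store.setArr, e1], rfl, fun z hz hzs => ?_⟩
              rcases Nat.lt_succ_iff_lt_or_eq.mp hz with hz | hz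
              · exact hlt.le.trans (hmin₁ z hz hzs)
              · rw [hz]
            · refine ⟨y₁, by rw [e1, hy₁], hsep₁, fun z hz hzs => ?_⟩
              rcases Nat.lt_succ_iff_lt_or_eq.mp hz with hz | hz
              · exact hmin₁ z hz hzs
              · rw [hz]; exact not_lt.mp hlt
          · obtain ⟨y, hy, hsep, hmin⟩ := h3 x
            refine ⟨y, ?_, hsep, fun z hz hzs => ?_⟩
            · split_ifs <;> simp [Store.setArr, e1, hx, hy]
            · rcases Nat.lt_succ_iff_lt_or_eq.mp hz with hz | hz
              · exact hmin z hz hzs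
              · have : I.sep t z = I.sep t w := Inst.sep_congr fun v hv _ => Inst.eq_of_idx_eq hz hv
                exact absurd (hzs.symm.trans this) hx
        · have hne : i ≠ I.off t + I.sep t w := by
            have := Inst.sep_lt (I := I) t w
            rw [Inst.off_succ] at hi
            omega
          split_ifs <;> simp [Store.setArr, e1, hne, h4 i hi]
    · intro s₂ _ ⟨h3, h4⟩
      refine ⟨fun x => ?_, h4⟩
      obtain ⟨y, hy, hsep, hmin⟩ := h3 x
      exact ⟨y, hy, hsep, fun z => hmin z (Inst.idx_lt _ _)⟩

/-- The root is its own parent, so there the loop overwrites the table that it reads. Its cost is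
still bounded, but its effect is asserted only for `p < t`. -/
theorem triple_push (hI : I.Valid) (hs : Static I s) {t p : ℕ} (hp : p < I.m)
    (hkey : s.var .key = I.off p) (ho : s.var .o = I.off t) (hb : s.var .b = I.bl p)
    (hacc : p < t → ∀ y, s.arr .acc (I.idx p y) = I.sep t y)
    (harg : ∀ x, ∃ y, s.arr .arg (I.off t + I.sep t x) = I.idx t y) :
    Triple push s (1 + 2 ^ I.bl p * (1 + 1)) fun s' => p < t → ∀ u x,
      s'.tab (I.off u + I.idx u x) = s.tab (I.off u + I.idx u x) +
        if u = p then s.tab (I.off t + s.arr .arg (I.off t + I.sep t x)) else 0 := by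
  have hpw := hs.pw _ (hI.bl_le p hp)
  refine (Triple.loop_const (2 ^ I.bl p) (by simp [NExp.eval, hb, hpw]) 1 (fun k s' =>
      p < t → ∀ u x, s'.tab (I.off u + I.idx u x) = s.tab (I.off u + I.idx u x) +
        if u = p ∧ I.idx u x < k then s.tab (I.off t + s.arr .arg (I.off t + I.sep t x)) else 0)
      (by simp) ?_).mono le_rfl ?_
  · intro k hk s₁ hf h
    obtain ⟨w, rfl⟩ := hI.exists_idx_eq hp hk
    refine ⟨le_rfl, fun hpt u x => ?_⟩
    have hkey₁ : s₁.var .key = I.off p := (hf.var _ rfl).trans hkey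
    have ho₁ : s₁.var .o = I.off t := (hf.var _ rfl).trans ho
    have hacc₁ : s₁.arr .acc = s.arr .acc := hf.arr _ rfl
    have harg₁ : s₁.arr .arg = s.arr .arg := hf.arr _ rfl
    have e1 : (Store.setVar s₁ .a (I.idx p w)).arr = s₁.arr := rfl
    have e2 : (Store.setVar s₁ .a (I.idx p w)).tab = s₁.tab := rfl
    have e3 : (Store.setVar s₁ .a (I.idx p w)).var .a = I.idx p w := by simp [Store.setVar]
    have e4 : (Store.setVar s₁ .a (I.idx p w)).var .o = I.off t := by simp [Store.setVar, ho₁]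
    have e5 : (Store.setVar s₁ .a (I.idx p w)).var .key = I.off p := by
      simp [Store.setVar, hkey₁]
    -- Only the block of `p` has been changed, and `p < t`, so the minimum read from the block of
    -- `t` is still the original one.
    have ht : s₁.tab (I.off t + s.arr .arg (I.off t + I.sep t w)) =
        s.tab (I.off t + s.arr .arg (I.off t + I.sep t w)) := by
      obtain ⟨y, hy⟩ := harg w
      rw [hy, h hpt t y]
      simp [hpt.ne']
    have hx := h hpt u x
    simp only [Cmd.run, IExp.eval, NExp.eval, e1, e2, e3, e4, e5, hacc₁, hacc hpt, harg₁, ht]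
    by_cases hcase : u = p ∧ I.idx u x = I.idx p w
    · obtain ⟨rfl, hxw⟩ := hcase
      have : I.sep t x = I.sep t w := by
        rw [← hacc hpt, ← hacc hpt, hxw]
      simp [Store.setTab, hxw, h hpt, this]
    · have hne : I.off u + I.idx u x ≠ I.off p + I.idx p w := by
        rwa [Ne, Inst.off_add_eq (Inst.idx_lt _ _) (Inst.idx_lt _ _)]
      have : (u = p ∧ I.idx u x < I.idx p w + 1) ↔ (u = p ∧ I.idx u x < I.idx p w) := by
        constructor
        · rintro ⟨h1, h2⟩
          exact ⟨h1, lt_of_le_of_ne (Nat.lt_succ_iff.mp h2) fun h => hcase ⟨h1, h⟩⟩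
        · rintro ⟨h1, h2⟩; exact ⟨h1, by omega⟩
      simp only [this, ← hx]
      simp [Store.setTab, hne, e2]
  · intro s₁ _ h hpt u x
    rw [h hpt u x]
    congr 2
    rw [eq_iff_iff]
    exact ⟨fun h => h.1, fun h => ⟨h, h ▸ Inst.idx_lt _ _⟩⟩

theorem sum_bag_sep {t : ℕ} {mark : ℕ → ℕ}
    (h : ∀ l < I.bl t, mark (I.bg t l) = if I.top (I.bg t l) < t then 2 ^ l else 0)
    (y : ℕ → Bool) :
    ∑ l ∈ Finset.range (I.bl t), (y (I.bg t l)).toNat * mark (I.bg t l) = I.sep t y := by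
  refine Finset.sum_congr rfl fun l hl => ?_
  rw [h l (Finset.mem_range.mp hl)]
  split_ifs with hc <;> simp [hc]

theorem triple_eliminateNode (hI : I.Valid) {W : ℕ} (hW : ∀ t < I.m, 2 ^ I.bl t ≤ W)
    (hs : Static I s) (hmark : ∀ v, s.arr .mark v = 0) {t r : ℕ} (htr : t + r + 1 = I.m)
    (hsr : s.var .r = r) :
    Triple eliminateNode s (13 + 33 * W) fun s' => (∀ v, s'.arr .mark v = 0) ∧
      (∀ x, ∃ y, s'.arr .arg (I.off t + I.sep t x) = I.idx t y ∧ I.sep t y = I.sep t x ∧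
        ∀ z, I.sep t z = I.sep t x →
          s.tab (I.off t + I.idx t y) ≤ s.tab (I.off t + I.idx t z)) ∧
      (∀ i, I.off (t + 1) ≤ i → s'.arr .arg i = s.arr .arg i) ∧
      (0 < t → ∀ u x, s'.tab (I.off u + I.idx u x) = s.tab (I.off u + I.idx u x) +
        if u = I.par t then s.tab (I.off t + s'.arr .arg (I.off t + I.sep t x)) else 0) := by
  have ht : t < I.m := by omega
  have hpm : I.par t < I.m := by
    rcases Nat.eq_zero_or_pos t with rfl | h0
    · rwa [hI.par_zero]
    · exact (hI.par_lt t ht h0).trans ht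
  have hsmall : I.bl t ≤ 2 ^ I.bl t := Nat.lt_two_pow_self.le
  have hWt := hW t ht
  have hWp := hW _ hpm
  refine Triple.mono (B := 1 + (1 + (1 + (1 + ((1 + I.bl t * (1 + (1 + 2))) + (10 * 2 ^ I.bl t +
    (((1 + 2 ^ I.bl t * (1 + 1)) + (1 + 2 ^ I.bl t * (1 + 2))) + (1 + (1 +
    (10 * 2 ^ I.bl (I.par t) + ((1 + 2 ^ I.bl (I.par t) * (1 + 1)) + (1 + (1 +
    (1 + I.bl t * (1 + 1))))))))))))))) ?_ ?_ fun _ _ h => h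
  swap
  · generalize 2 ^ I.bl t = a at *
    generalize 2 ^ I.bl (I.par t) = b at *
    linarith
  refine Triple.set (Triple.set (Triple.set (Triple.set ?_)))
  set S := Store.setVar _ .o _ with hS
  have htm : I.m - (r + 1) = t := by omega
  have hSt : S.var .t = t := by simp [hS, Store.setVar, NExp.eval, hs.m, hsr, htm]
  have hSz : S.var .z = I.np t := by
    simp [hS, Store.setVar, NExp.eval, hs.m, hsr, htm, hs.np t ht]
  have hSb : S.var .b = I.bl t := by
    simp [hS, Store.setVar, NExp.eval, hs.m, hsr, htm, hs.np t ht, hs.raw, hI.inp_bl t ht]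
  have hSo : S.var .o = I.off t := by
    simp [hS, Store.setVar, NExp.eval, hs.m, hsr, htm, hs.off t ht]
  have hSs : Static I S := (((hs.setVar _ rfl).setVar _ rfl).setVar _ rfl).setVar _ rfl
  have hSarr : S.arr = s.arr := rfl
  have hStab : S.tab = s.tab := rfl
  clear_value S
  refine Triple.seq (triple_markSep hI hSs ht hSt hSz hSb (by rwa [hSarr])) ?_
  intro s₁ hf₁ ⟨hm1, hm2⟩
  have hs₁ := hSs.frame hf₁ rfl
  have ht₁ : s₁.var .t = t := (hf₁.var _ rfl).trans hSt
  have ho₁ : s₁.var .o = I.off t := (hf₁.var _ rfl).trans hSo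
  have htab₁ : s₁.tab = s.tab := (hf₁.tab rfl).trans hStab
  have harg₁ : s₁.arr .arg = s.arr .arg := by rw [hf₁.arr _ rfl, hSarr]
  refine Triple.seq (triple_sums hI hs₁ ht₁ ht) ?_
  intro s₂ hf₂ ⟨hz₂, hb₂, hacc₂⟩
  have hs₂ := hs₁.frame hf₂ rfl
  have ht₂ : s₂.var .t = t := (hf₂.var _ rfl).trans ht₁
  have ho₂ : s₂.var .o = I.off t := (hf₂.var _ rfl).trans ho₁
  have htab₂ : s₂.tab = s.tab := (hf₂.tab rfl).trans htab₁
  have harg₂ : s₂.arr .arg = s.arr .arg := (hf₂.arr _ rfl).trans harg₁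
  have hmark₂ : s₂.arr .mark = s₁.arr .mark := hf₂.arr _ rfl
  refine Triple.seq (triple_optimize hI hs₂ ht ho₂ hb₂
    fun y => (hacc₂ y).trans (sum_bag_sep hm1 y)) ?_
  rw [htab₂, harg₂]
  intro s₃ hf₃ ⟨hopt, harg₃⟩
  have hs₃ := hs₂.frame hf₃ rfl
  have ht₃ : s₃.var .t = t := (hf₃.var _ rfl).trans ht₂
  have ho₃ : s₃.var .o = I.off t := (hf₃.var _ rfl).trans ho₂
  have hz₃ : s₃.var .z = I.np t := (hf₃.var _ rfl).trans hz₂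
  have htab₃ : s₃.tab = s.tab := (hf₃.tab rfl).trans htab₂
  have hmark₃ : s₃.arr .mark = s₁.arr .mark := (hf₃.arr _ rfl).trans hmark₂
  refine Triple.set (Triple.set ?_)
  set R := Store.setVar _ .key _ with hR
  have hRp : R.var .p = I.par t := by
    simp [hR, Store.setVar, NExp.eval, hz₃, hs₃.raw, hI.inp_par t ht]
  have hRkey : R.var .key = I.off (I.par t) := by
    simp [hR, Store.setVar, NExp.eval, hz₃, hs₃.raw, hI.inp_par t ht, hs₃.off _ hpm]
  have hRt : R.var .t = t := by simp [hR, Store.setVar, ht₃]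
  have hRo : R.var .o = I.off t := by simp [hR, Store.setVar, ho₃]
  have hRs : Static I R := (hs₃.setVar _ rfl).setVar _ rfl
  have hRarr : R.arr = s₃.arr := rfl
  have hRtab : R.tab = s.tab := htab₃
  clear_value R
  refine Triple.seq (triple_sums hI hRs hRp hpm) ?_
  intro s₄ hf₄ ⟨hz₄, hb₄, hacc₄⟩
  have hs₄ := hRs.frame hf₄ rfl
  have ht₄ : s₄.var .t = t := (hf₄.var _ rfl).trans hRt
  have ho₄ : s₄.var .o = I.off t := (hf₄.var _ rfl).trans hRo
  have hkey₄ : s₄.var .key = I.off (I.par t) := (hf₄.var _ rfl).trans hRkey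
  have htab₄ : s₄.tab = s.tab := (hf₄.tab rfl).trans hRtab
  have harg₄ : s₄.arr .arg = s₃.arr .arg := by rw [hf₄.arr _ rfl, hRarr]
  have hmark₄ : s₄.arr .mark = s₁.arr .mark := by rw [hf₄.arr _ rfl, hRarr, hmark₃]
  have hacc₄' : I.par t < t → ∀ y, s₄.arr .acc (I.idx (I.par t) y) = I.sep t y := by
    intro _ y
    -- Both subset sums equal the sum over all variables, because the marks are supported in the
    -- separator, which by `par_mem` lies in both bags.
    rw [hacc₄, hRarr, hmark₃, ← sum_bag_sep hm1 y,
      hI.sum_bag hpm (fun v => (y v).toNat * s₁.arr .mark v),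
      hI.sum_bag ht (fun v => (y v).toNat * s₁.arr .mark v)]
    · exact fun v hv => (hm2 v (right_ne_zero_of_mul hv)).1
    · intro v hv
      have := hm2 v (right_ne_zero_of_mul hv)
      exact hI.par_mem t ht v this.1 this.2
  refine Triple.seq (triple_push hI hs₄ hpm hkey₄ ho₄ hb₄ hacc₄' ?_) ?_
  · intro x
    obtain ⟨y, hy, _⟩ := hopt x
    exact ⟨y, by rw [harg₄, hy]⟩
  rw [htab₄, harg₄]
  intro s₅ hf₅ hpush
  have hs₅ := hs₄.frame hf₅ rfl
  have ht₅ : s₅.var .t = t := (hf₅.var _ rfl).trans ht₄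
  have harg₅ : s₅.arr .arg = s₃.arr .arg := (hf₅.arr _ rfl).trans harg₄
  have hmark₅ : s₅.arr .mark = s₁.arr .mark := (hf₅.arr _ rfl).trans hmark₄
  refine Triple.set (Triple.set ?_)
  set V := Store.setVar _ .b _ with hV
  have hVs : Static I V := (hs₅.setVar _ rfl).setVar _ rfl
  have hVz : V.var .z = I.np t := by
    simp [hV, Store.setVar, NExp.eval, ht₅, hs₅.np t ht]
  have hVb : V.var .b = I.bl t := by
    simp [hV, Store.setVar, NExp.eval, ht₅, hs₅.np t ht, hs₅.raw, hI.inp_bl t ht]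
  have hVarr : V.arr = s₅.arr := rfl
  have hVtab : V.tab = s₅.tab := rfl
  clear_value V
  refine (triple_unmark hI hVs ht hVz hVb fun v hv => ?_).mono le_rfl fun s₆ hf₆ hm₆ => ?_
  · rw [hVarr, hmark₅] at hv
    exact (hm2 v hv).1
  · have harg₆ : s₆.arr .arg = s₃.arr .arg := by rw [hf₆.arr _ rfl, hVarr, harg₅]
    have htab₆ : s₆.tab = s₅.tab := (hf₆.tab rfl).trans hVtab
    refine ⟨hm₆, ?_, ?_, ?_⟩
    · rw [harg₆]; exact hopt
    · rw [harg₆]; exact harg₃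
    · rw [harg₆, htab₆]
      exact fun h0 => hpush (hI.par_lt t ht h0)

/-- After the elimination of the nodes from `t` on, up to a constant, the energy is the sum of the
tables of the remaining nodes and of nonnegative functions `D u` of the bags of the eliminated nodes
which can be made zero one after the other by means of the array `arg`. -/
def Eliminated (I : Inst) (t : ℕ) (s : Store) : Prop :=
  ∃ (c : ℤ) (D : ℕ → (ℕ → Bool) → ℤ),
    (∀ u, t ≤ u → u < I.m → ∀ x, 0 ≤ D u x) ∧
    (∀ u, t ≤ u → u < I.m → ∀ x y, (∀ v, I.Mem u v → x v = y v) → D u x = D u y) ∧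
    (∀ u, t ≤ u → u < I.m → ∀ x, ∃ y, s.arr .arg (I.off u + I.sep u x) = I.idx u y ∧
      I.sep u y = I.sep u x ∧ D u y = 0) ∧
    ∀ x, I.energy x = c + ∑ u ∈ Finset.range t, s.tab (I.off u + I.idx u x) +
      ∑ u ∈ Finset.Ico t I.m, D u x

/-- The new function `E` is the table of `t` minus its minimum `M` over the extensions of a
separator assignment. The minimizer recorded in `arg` makes `E` zero without changing the separator,
and `M` moves to the parent's table. -/
theorem Eliminated.step (hI : I.Valid) {t : ℕ} (ht : t < I.m) (h : Eliminated I (t + 1) s)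
    (hopt : ∀ x, ∃ y, s'.arr .arg (I.off t + I.sep t x) = I.idx t y ∧ I.sep t y = I.sep t x ∧
        ∀ z, I.sep t z = I.sep t x →
          s.tab (I.off t + I.idx t y) ≤ s.tab (I.off t + I.idx t z))
    (harg : ∀ i, I.off (t + 1) ≤ i → s'.arr .arg i = s.arr .arg i)
    (htab : 0 < t → ∀ u x, s'.tab (I.off u + I.idx u x) = s.tab (I.off u + I.idx u x) +
        if u = I.par t then s.tab (I.off t + s'.arr .arg (I.off t + I.sep t x)) else 0) :
    Eliminated I t s' := by
  obtain ⟨c, D, h1, h2, h3, h4⟩ := h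
  set M : (ℕ → Bool) → ℤ := fun x => s.tab (I.off t + s'.arr .arg (I.off t + I.sep t x)) with hM
  set E : (ℕ → Bool) → ℤ := fun x => s.tab (I.off t + I.idx t x) - M x with hE
  have hD : ∀ u, t + 1 ≤ u → Function.update D t E u = D u := fun u hu =>
    Function.update_of_ne (by omega) _ _
  refine ⟨if t = 0 then c + M (fun _ => false) else c, Function.update D t E, ?_, ?_, ?_, ?_⟩
  · intro u hu hum x
    rcases hu.lt_or_eq with hu | rfl
    · rw [hD u hu]; exact h1 u hu hum x
    · obtain ⟨y, hy, _, hmin⟩ := hopt x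
      simp [hE, hM, hy, hmin x rfl]
  · intro u hu hum x y hxy
    rcases hu.lt_or_eq with hu | rfl
    · rw [hD u hu]; exact h2 u hu hum x y hxy
    · simp [hE, hM, Inst.idx_congr hxy, Inst.sep_congr fun v hv _ => hxy v hv]
  · intro u hu hum x
    rcases hu.lt_or_eq with hu | rfl
    · obtain ⟨y, hy⟩ := h3 u hu hum x
      refine ⟨y, ?_⟩
      rw [hD u hu, harg]
      · exact hy
      · have : I.off (t + 1) ≤ I.off u :=
          Finset.sum_le_sum_of_subset (Finset.range_mono hu)
        omega
    · obtain ⟨y, hy, hsep, hmin⟩ := hopt x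
      refine ⟨y, hy, hsep, ?_⟩
      simp [hE, hM, hsep, hy]
  · intro x
    rw [h4 x, Finset.sum_range_succ, Finset.sum_eq_sum_Ico_succ_bot ht, Function.update_self]
    have e1 : ∑ u ∈ Finset.Ico (t + 1) I.m, Function.update D t E u x =
        ∑ u ∈ Finset.Ico (t + 1) I.m, D u x :=
      Finset.sum_congr rfl fun u hu => by rw [hD u (Finset.mem_Ico.mp hu).1]
    rw [e1]
    -- At the root no variable occurs above, so `M` does not depend on `x` and joins the constant.
    rcases Nat.eq_zero_or_pos t with rfl | h0
    · have : M x = M fun _ => false := by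
        simp only [hM]
        rw [Inst.sep_congr (y := fun _ => false) fun v _ hv => absurd hv (Nat.not_lt_zero _)]
      simp [hE, ← this]
      ring
    · have e2 : ∑ u ∈ Finset.range t, s'.tab (I.off u + I.idx u x) =
          ∑ u ∈ Finset.range t, s.tab (I.off u + I.idx u x) + M x := by
        simp only [htab h0, Finset.sum_add_distrib, Finset.sum_ite_eq', Finset.mem_range,
          hI.par_lt t ht h0, if_true, hM]
      rw [e2, if_neg h0.ne']
      simp only [hE]
      ring

/-- Before the first pass no node is eliminated, so the invariant holds with constant 0 and is the
decomposition of the energy into tables. -/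
theorem triple_eliminate (hI : I.Valid) {W : ℕ} (hW : ∀ t < I.m, 2 ^ I.bl t ≤ W)
    (hs : Static I s) (hmark : ∀ v, s.arr .mark v = 0)
    (htab : ∀ t < I.m, ∀ x, s.tab (I.off t + I.idx t x) = ∑ q ∈ Finset.range I.T,
        if I.node q = t then (if x (I.ti q) && x (I.tj q) then I.wt q else 0) else 0) :
    Triple eliminate s (1 + I.m * (1 + (13 + 33 * W))) (Eliminated I 0) := by
  refine (Triple.loop_const I.m (by simpa [NExp.eval] using hs.m) (13 + 33 * W)
    (fun k s' => (∀ v, s'.arr .mark v = 0) ∧ Eliminated I (I.m - k) s')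
    ⟨hmark, 0, 0, ?_⟩ ?_).mono le_rfl fun s' _ h => by simpa using h.2
  · refine ⟨by simp, by simp, fun u h h' => by omega, fun x => ?_⟩
    rw [energy_eq_sum_tables hI]
    simp only [Nat.sub_zero, Finset.Ico_self, Finset.sum_empty, add_zero, zero_add]
    exact Finset.sum_congr rfl fun t ht => (htab t (Finset.mem_range.mp ht) x).symm
  · intro r hr s₁ hf ⟨hm, he⟩
    refine (triple_eliminateNode hI hW ((hs.frame hf rfl).setVar r rfl) hm
      (t := I.m - (r + 1)) (r := r) (by omega) (by simp [Store.setVar])).mono le_rfl ?_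
    intro s₂ _ ⟨hm₂, h1, h2, h3⟩
    refine ⟨hm₂, Eliminated.step (s := s₁) hI (by omega) ?_ h1 h2 h3⟩
    rwa [show I.m - (r + 1) + 1 = I.m - r by omega]

/-! ### Reading off the solution -/

/-- The stored position is decoded from the top digit downwards by comparison with the sum of the
digits found so far, as division is unavailable. -/
theorem triple_decodeNode (hI : I.Valid) {W : ℕ} (hW : ∀ t < I.m, 2 ^ I.bl t ≤ W)
    (hs : Static I s) {t : ℕ} (ht : t < I.m) (hst : s.var .t = t) {x y : ℕ → Bool}
    (hsol : ∀ v, s.arr .sol v = (x v).toNat) (hx : ∀ v, I.Mem t v → ¬ I.top v < t → x v = false)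
    (hy : s.arr .arg (I.off t + I.sep t x) = I.idx t y) (z : ℕ → Bool)
    (hz : ∀ v, I.Mem t v → z v = y v) (hz' : ∀ v, ¬ I.Mem t v → z v = x v) :
    Triple decodeNode s (8 + 9 * W) fun s' => ∀ v, s'.arr .sol v = (z v).toNat := by
  have hsmall : I.bl t ≤ 2 ^ I.bl t := Nat.lt_two_pow_self.le
  have hWt := hW t ht
  refine Triple.mono (B := 1 + (1 + (1 + (1 + ((1 + I.bl t * (1 + 2)) + (1 + (1 +
    (1 + I.bl t * (1 + 5))))))))) ?_ (by omega) fun _ _ h => h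
  refine Triple.set (Triple.set (Triple.set (Triple.set ?_)))
  set S := Store.setVar _ .key _ with hS
  have hSz : S.var .z = I.np t := by simp [hS, Store.setVar, NExp.eval, hst, hs.np t ht]
  have hSb : S.var .b = I.bl t := by
    simp [hS, Store.setVar, NExp.eval, hst, hs.np t ht, hs.raw, hI.inp_bl t ht]
  have hSo : S.var .o = I.off t := by simp [hS, Store.setVar, NExp.eval, hst, hs.off t ht]
  have hSkey : S.var .key = 0 := by simp [hS, Store.setVar, NExp.eval]
  have hSs : Static I S := (((hs.setVar _ rfl).setVar _ rfl).setVar _ rfl).setVar _ rfl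
  have hSarr : S.arr = s.arr := rfl
  clear_value S
  refine Triple.seq (R := fun s' => s'.var .key = I.sep t x) ?_ ?_
  · refine Triple.loop_const (I.bl t) (by simpa [NExp.eval] using hSb) 2 (fun k s' =>
      s'.var .key = binary k fun l => decide (I.top (I.bg t l) < t) && x (I.bg t l))
      (by simp [hSkey, binary]) ?_
    intro l hl s₁ hf h
    have hs₁ := hSs.frame hf rfl
    have hz₁ : s₁.var .z = I.np t := (hf.var _ rfl).trans hSz
    have hsol₁ : s₁.arr .sol = s.arr .sol := by rw [hf.arr _ rfl, hSarr]
    have e1 : (Store.setVar s₁ .l l).raw = I.inp := hs₁.raw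
    have e2 : (Store.setVar s₁ .l l).var .l = l := by simp [Store.setVar]
    have e3 : (Store.setVar s₁ .l l).var .z = I.np t := by simp [Store.setVar, hz₁]
    have e4 : (Store.setVar s₁ .l l).arr = s₁.arr := rfl
    have e5 : (Store.setVar s₁ .l l).var .key = s₁.var .key := by simp [Store.setVar]
    have hpw := hs₁.pw l (hl.le.trans (hI.bl_le t ht))
    refine ⟨?_, ?_⟩
    · simp only [Cmd.cost, cost_skip]; split_ifs <;> omega
    -- Variables whose topmost node is `t` are still `false`, so encoding the whole bag gives the
    -- separator position.
    · have hxx : (decide (I.top (I.bg t l) < t) && x (I.bg t l)) = x (I.bg t l) := by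
        by_cases hc : I.top (I.bg t l) < t
        · simp [hc]
        · simp [hx _ ⟨l, hl, rfl⟩ hc]
      rw [binary_succ, hxx, ← h]
      simp only [Cmd.run, IExp.eval, NExp.eval, e1, e2, e3, e4, e5, hI.inp_bg t ht l hl, hsol₁, hsol,
        Int.toNat_natCast, hpw, run_skip]
      cases x (I.bg t l) <;> simp [Store.setVar]
  intro s₁ hf₁ hkey
  have hs₁ := hSs.frame hf₁ rfl
  have hz₁ : s₁.var .z = I.np t := (hf₁.var _ rfl).trans hSz
  have hb₁ : s₁.var .b = I.bl t := (hf₁.var _ rfl).trans hSb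
  have ho₁ : s₁.var .o = I.off t := (hf₁.var _ rfl).trans hSo
  have hsol₁ : s₁.arr .sol = s.arr .sol := by rw [hf₁.arr _ rfl, hSarr]
  have harg₁ : s₁.arr .arg = s.arr .arg := by rw [hf₁.arr _ rfl, hSarr]
  refine Triple.set (Triple.set ?_)
  set R := Store.setVar _ .cur _ with hR
  have hRz : R.var .z = I.np t := by simp [hR, Store.setVar, hz₁]
  have hRb : R.var .b = I.bl t := by simp [hR, Store.setVar, hb₁]
  have hRbest : R.var .best = I.idx t y := by
    simp [hR, Store.setVar, NExp.eval, ho₁, hkey, harg₁, hy]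
  have hRcur : R.var .cur = 0 := by simp [hR, Store.setVar, NExp.eval]
  have hRs : Static I R := (hs₁.setVar _ rfl).setVar _ rfl
  have hRarr : R.arr .sol = s.arr .sol := hsol₁
  clear_value R
  refine (Triple.loop_const (I.bl t) (by simpa [NExp.eval] using hRb) 5 (fun k s' =>
    s'.var .cur + binary (I.bl t - k) (fun l => y (I.bg t l)) = I.idx t y ∧
    (∀ l < I.bl t, I.bl t - k ≤ l → s'.arr .sol (I.bg t l) = (y (I.bg t l)).toNat) ∧
    ∀ v, ¬ I.Mem t v → s'.arr .sol v = (x v).toNat) ?_ ?_).mono le_rfl ?_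
  · refine ⟨by simp [hRcur, Inst.idx], fun l h h' => by omega, fun v _ => by rw [hRarr, hsol]⟩
  · intro k hk s₂ hf₂ ⟨h1, h2, h3⟩
    have hs₂ := hRs.frame hf₂ rfl
    have hz₂ : s₂.var .z = I.np t := (hf₂.var _ rfl).trans hRz
    have hb₂ : s₂.var .b = I.bl t := (hf₂.var _ rfl).trans hRb
    have hbest₂ : s₂.var .best = I.idx t y := (hf₂.var _ rfl).trans hRbest
    refine Triple.mono (B := 1 + (1 + 3)) ?_ le_rfl fun _ _ h => h
    refine Triple.set (Triple.set ?_)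
    obtain ⟨q, hq⟩ : ∃ q, q = I.bl t - (k + 1) := ⟨_, rfl⟩
    have hql : q < I.bl t := by omega
    set V := Store.setVar _ .v _ with hV
    have hVq : V.var .q = q := by simp [hV, Store.setVar, NExp.eval, hb₂, hq]
    have hVv : V.var .v = I.bg t q := by
      simp [hV, Store.setVar, NExp.eval, hb₂, ← hq, hz₂, hs₂.raw, hI.inp_bg t ht q hql]
    have hVbest : V.var .best = I.idx t y := by simp [hV, Store.setVar, hbest₂]
    have hVcur : V.var .cur = s₂.var .cur := by simp [hV, Store.setVar]
    have hVarr : V.arr = s₂.arr := rfl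
    have hpw : V.arr .pw q = 2 ^ q := hs₂.pw q (hql.le.trans (hI.bl_le t ht))
    clear_value V
    have hbin := binary_succ q fun l => y (I.bg t l)
    have hlt := binary_lt q fun l => y (I.bg t l)
    rw [show q + 1 = I.bl t - k by omega] at hbin
    rw [hbin] at h1
    have hmem : I.Mem t (I.bg t q) := ⟨q, hql, rfl⟩
    -- The undecoded digits below `q` contribute less than `2 ^ q`, so the comparison reveals digit
    -- `q`.
    have hcond : I.idx t y < s₂.var .cur + 2 ^ q ↔ y (I.bg t q) = false := by
      cases hyq : y (I.bg t q) <;> simp [hyq] at h1 ⊢ <;> omega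
    rw [← hq]
    refine ⟨?_, ?_⟩
    · simp only [Cmd.cost]; split_ifs <;> omega
    · simp only [Cmd.run, IExp.eval, NExp.eval, hVbest, hVcur, hVq, hpw, hVv, Nat.cast_lt, hcond]
      cases hyq : y (I.bg t q)
      · simp only [hyq, Bool.toNat_false, Nat.zero_mul, add_zero] at h1
        simp only [if_true]
        refine ⟨by simpa [Store.setArr, hVcur] using h1, fun l hl hql' => ?_, fun v hv => ?_⟩
        · by_cases hlq : l = q
          · simp [Store.setArr, hlq, hyq]
          · have : I.bg t l ≠ I.bg t q := fun h => hlq (hI.bg_inj t ht l hl q hql h)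
            simp [Store.setArr, this, hVarr, h2 l hl (by omega)]
        · have : v ≠ I.bg t q := by rintro rfl; exact hv hmem
          simp [Store.setArr, this, hVarr, h3 v hv]
      · simp only [hyq, Bool.toNat_true, Nat.one_mul] at h1
        simp only [Bool.true_eq_false, if_false]
        refine ⟨?_, fun l hl hql' => ?_, fun v hv => ?_⟩
        · simp [Store.setArr, Store.setVar, hVcur, hVq, hpw]
          omega
        · by_cases hlq : l = q
          · simp [Store.setArr, Store.setVar, hlq, hyq]
          · have : I.bg t l ≠ I.bg t q := fun h => hlq (hI.bg_inj t ht l hl q hql h)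
            simp [Store.setArr, Store.setVar, this, hVarr, h2 l hl (by omega)]
        · have : v ≠ I.bg t q := by rintro rfl; exact hv hmem
          simp [Store.setArr, Store.setVar, this, hVarr, h3 v hv]
  · intro s₂ _ ⟨_, h2, h3⟩ v
    by_cases hv : I.Mem t v
    · rw [hz v hv]
      obtain ⟨l, hl, rfl⟩ := hv
      exact h2 l hl (by simp)
    · rw [hz' v hv, h3 v hv]

/-- The invariant says that the functions of the visited nodes vanish and that variables not yet
reached are `false`. After the last node the energy is the constant `c`, below which no vector can
go. -/
theorem triple_decode (hI : I.Valid) {W : ℕ} (hW : ∀ t < I.m, 2 ^ I.bl t ≤ W)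
    (hs : Static I s) (hsol : ∀ v, s.arr .sol v = 0) (he : Eliminated I 0 s) :
    Triple decode s (1 + I.m * (1 + (8 + 9 * W))) fun s' => ∃ x : ℕ → Bool,
      (∀ v, s'.arr .sol v = (x v).toNat) ∧ ∀ y, I.energy x ≤ I.energy y := by
  classical
  obtain ⟨c, D, h1, h2, h3, h4⟩ := he
  refine (Triple.loop_const I.m (by simpa [NExp.eval] using hs.m) (8 + 9 * W)
    (fun t s' => ∃ x : ℕ → Bool, (∀ v, s'.arr .sol v = (x v).toNat) ∧
      (∀ u < t, D u x = 0) ∧ ∀ v, t ≤ I.top v → x v = false)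
    ⟨fun _ => false, by simpa using hsol, by simp, by simp⟩ ?_).mono le_rfl ?_
  · intro t ht s₁ hf ⟨x, hx1, hx2, hx3⟩
    obtain ⟨y, hy1, hy2, hy3⟩ := h3 t (Nat.zero_le _) ht x
    set z : ℕ → Bool := fun v => if I.Mem t v then y v else x v with hz
    -- A variable occurring above `t` lies in the separator if it is in the bag at all, and `y`
    -- agrees with `x` there. Hence the functions of earlier bags stay zero.
    have hzx : ∀ v, I.top v < t → z v = x v := by
      intro v hv
      simp only [hz]
      split_ifs with hm
      · exact Inst.eq_of_sep_eq hy2 hm hv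
      · rfl
    have harg : (Store.setVar s₁ .t t).arr .arg = s.arr .arg := hf.arr _ rfl
    refine (triple_decodeNode hI hW ((hs.frame hf rfl).setVar t rfl) ht (by simp [Store.setVar])
      (x := x) (y := y) hx1 (fun v _ hv => hx3 v (not_lt.mp hv)) (by rw [harg, hy1]) z
      (fun v hv => by simp [hz, hv]) (fun v hv => by simp [hz, hv])).mono le_rfl ?_
    intro s₂ _ h
    refine ⟨z, h, fun u hu => ?_, fun v hv => ?_⟩
    · rcases Nat.lt_succ_iff_lt_or_eq.mp hu with hu | rfl
      · rw [← hx2 u hu]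
        exact h2 u (Nat.zero_le _) (by omega) _ _ fun v hv =>
          hzx v ((hI.top_le u (by omega) v hv).trans_lt hu)
      · rw [← hy3]
        exact h2 u (Nat.zero_le _) ht _ _ fun v hv => by simp [hz, hv]
    · have : ¬ I.Mem t v := fun hm => by
        have := hI.top_le t ht v hm
        omega
      simp [hz, this, hx3 v (by omega)]
  · intro s₁ _ ⟨x, hx1, hx2, _⟩
    refine ⟨x, hx1, fun y => ?_⟩
    rw [h4 x, h4 y]
    simp only [Finset.range_zero, Finset.sum_empty, add_zero]
    gcongr c + ?_
    refine Finset.sum_le_sum fun u hu => ?_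
    have hu := (Finset.mem_Ico.mp hu).2
    rw [hx2 u hu]
    exact h1 u (Nat.zero_le _) hu y

theorem triple_solve (hI : I.Valid) {W : ℕ} (hW : ∀ t < I.m, 2 ^ I.bl t ≤ W)
    (hraw : s.raw = I.inp) (harr : ∀ A v, s.arr A v = 0) (htab : ∀ i, s.tab i = 0) :
    Triple solve s (13 + 4 * I.n + I.m * (30 + 46 * W) + I.T * (13 + 13 * W)) fun s' =>
      ∃ x : ℕ → Bool, (∀ v < I.n, s'.raw v = (x v).toNat) ∧ ∀ y, I.energy x ≤ I.energy y := by
  refine Triple.mono (B := (6 + 2 * I.n) + ((3 + I.m * (7 + 4 * W)) +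
    ((1 + I.T * (1 + (12 + 13 * W))) + ((1 + I.m * (1 + (13 + 33 * W))) +
      ((1 + I.m * (1 + (8 + 9 * W))) + (1 + I.n * (1 + 1))))))) ?_ ?_ fun _ _ h => h
  · refine Triple.seq (triple_readSizes hI hraw) ?_
    intro s₁ hf₁ ⟨hn, hT, hm, hp, hpw⟩
    refine Triple.seq (triple_readNodes hI hW ((hf₁.raw rfl).trans hraw) hn hT hm hp hpw
      fun v => by rw [hf₁.arr _ rfl, harr]) ?_
    intro s₂ hf₂ hs₂
    have hmark₂ : ∀ v, s₂.arr .mark v = 0 := fun v => by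
      rw [hf₂.arr _ rfl, hf₁.arr _ rfl, harr]
    have hsol₂ : ∀ v, s₂.arr .sol v = 0 := fun v => by
      rw [hf₂.arr _ rfl, hf₁.arr _ rfl, harr]
    have htab₂ : ∀ v, s₂.tab v = 0 := fun v => by
      rw [hf₂.tab rfl, hf₁.tab rfl, htab]
    refine Triple.seq (triple_addTerms hI hW hs₂ hmark₂ htab₂) ?_
    intro s₃ hf₃ ⟨hmark₃, htab₃⟩
    have hs₃ := hs₂.frame hf₃ rfl
    refine Triple.seq (triple_eliminate hI hW hs₃ hmark₃ htab₃) ?_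
    intro s₄ hf₄ he
    have hs₄ := hs₃.frame hf₄ rfl
    refine Triple.seq (triple_decode hI hW hs₄ (fun v => by
      rw [hf₄.arr _ rfl, hf₃.arr _ rfl, hsol₂]) he) ?_
    intro s₅ hf₅ ⟨x, hx, hmin⟩
    have hs₅ := hs₄.frame hf₅ rfl
    refine (Triple.loop_const I.n (by simpa [NExp.eval] using hs₅.n) 1 (fun k s' =>
      ∀ v < k, s'.raw v = (x v).toNat) (by simp) ?_).mono le_rfl fun s₆ _ h => ⟨x, h, hmin⟩
    intro k hk s₆ hf₆ h
    have hsol₆ : s₆.arr .sol = s₅.arr .sol := hf₆.arr _ rfl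
    refine ⟨le_rfl, fun v hv => ?_⟩
    by_cases hvk : v = k
    · simp [Cmd.run, Store.setRaw, Store.setVar, IExp.eval, NExp.eval, hvk, hsol₆, hx]
    · simp [Cmd.run, Store.setRaw, Store.setVar, IExp.eval, NExp.eval, hvk, h v (by omega)]
  · apply le_of_eq
    ring

end Loop

/-! ### The instance presented by an input -/

theorem getD_flatMap_append {α : Type*} (L : List α) (f : α → List ℤ) (d : α) (post : List ℤ)
    {t j : ℕ} (ht : t < L.length) (hj : j < (f (L.getD t d)).length) :
    (L.flatMap f ++ post).getD (∑ u ∈ Finset.range t, (f (L.getD u d)).length + j) 0 =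
      (f (L.getD t d)).getD j 0 := by
  induction L generalizing t with
  | nil => simp at ht
  | cons a L ih =>
    rw [List.flatMap_cons, List.append_assoc]
    cases t with
    | zero =>
      simp only [List.getD_cons_zero] at hj
      simp [List.getElem?_append, hj]
    | succ t =>
      simp only [List.getD_cons_succ] at hj ⊢
      rw [Finset.sum_range_succ', List.getD_append_right _ _ _ _ (by simp; omega)]
      simp only [List.getD_cons_succ, List.getD_cons_zero]
      rw [← ih (by simpa using ht) hj]
      congr 1
      omega

namespace Presentation

variable {H : Hamiltonian} {D : TreeDecomposition H.primalGraph} (I : Presentation H D)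

/-- The terms as natural numbers with their weights. -/
def termList : List (ℕ × ℕ × ℤ) := I.terms.map fun p => (p.1, p.2, H.weight p.1 p.2)

/-- The nodes as pairs of a parent and a list of elements of the bag. -/
def nodeList : List (ℕ × List ℕ) :=
  (List.finRange D.m).map fun t => ((I.parent t : ℕ), (I.bags t).map fun v : Fin H.n => (v : ℕ))

/-- The instance given by a presentation. -/
noncomputable def toInst : Inst where
  n := H.n
  T := I.terms.length
  m := D.m
  inp i := I.encode.getD i 0
  ti q := (I.termList.getD q (0, 0, 0)).1
  tj q := (I.termList.getD q (0, 0, 0)).2.1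
  wt q := (I.termList.getD q (0, 0, 0)).2.2
  par t := (I.nodeList.getD t (0, [])).1
  bl t := (I.nodeList.getD t (0, [])).2.length
  bg t l := (I.nodeList.getD t (0, [])).2.getD l 0
  top v := sInf {t | ∃ (ht : t < D.m) (hv : v < H.n), (⟨v, hv⟩ : Fin H.n) ∈ I.bags ⟨t, ht⟩}

theorem length_nodeList : I.nodeList.length = D.m := by simp [nodeList]

theorem length_termList : I.termList.length = I.terms.length := by simp [termList]

theorem getD_nodeList {t : ℕ} (ht : t < D.m) : I.nodeList.getD t (0, []) =
    ((I.parent ⟨t, ht⟩ : ℕ), (I.bags ⟨t, ht⟩).map fun v : Fin H.n => (v : ℕ)) := by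
  simp [nodeList, ht]

theorem getD_termList {q : ℕ} (hq : q < I.terms.length) : I.termList.getD q (0, 0, 0) =
    ((I.terms[q].1 : ℕ), (I.terms[q].2 : ℕ), H.weight I.terms[q].1 I.terms[q].2) := by
  simp [termList, hq]

def termCode (p : ℕ × ℕ × ℤ) : List ℤ := [(p.1 : ℤ), (p.2.1 : ℤ), p.2.2]

def nodeCode (p : ℕ × List ℕ) : List ℤ :=
  [(p.1 : ℤ), (p.2.length : ℤ)] ++ p.2.map fun v : ℕ => (v : ℤ)

/-- The bracketing and the final empty list give both variable-length sections the shape required by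
`getD_flatMap_append`. -/
theorem encode_eq : I.encode = [(H.n : ℤ), (I.terms.length : ℤ)] ++ (I.termList.flatMap termCode ++
    ([(D.m : ℤ)] ++ (I.nodeList.flatMap nodeCode ++ []))) := by
  simp [encode, termList, nodeList, termCode, nodeCode, List.flatMap_map, Function.comp_def,
    ← List.map_eq_flatMap]

theorem length_flatMap_termCode (L : List (ℕ × ℕ × ℤ)) :
    (L.flatMap termCode).length = L.length + L.length + L.length := by
  induction L with
  | nil => rfl
  | cons a L ih => simp [ih, termCode]; omega

theorem inp_term {q j : ℕ} (hq : q < I.terms.length) (hj : j < 3) :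
    I.toInst.inp (2 + (q + q + q) + j) = (termCode (I.termList.getD q (0, 0, 0))).getD j 0 := by
  have h := getD_flatMap_append I.termList termCode (0, 0, 0)
    ([(D.m : ℤ)] ++ (I.nodeList.flatMap nodeCode ++ [])) (t := q) (j := j)
    (by rwa [length_termList]) (by simpa [termCode] using hj)
  have e : ∑ u ∈ Finset.range q, (termCode (I.termList.getD u (0, 0, 0))).length = q + q + q := by
    simp [termCode]; omega
  rw [e] at h
  rw [← h]
  change I.encode.getD _ 0 = _
  rw [encode_eq, List.getD_append_right _ _ _ _ (by simp; omega)]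
  congr 1
  simp; omega

theorem inp_m : I.toInst.inp (2 + (I.terms.length + I.terms.length + I.terms.length)) = D.m := by
  change I.encode.getD _ 0 = _
  rw [encode_eq, List.getD_append_right _ _ _ _ (by simp), List.getD_append_right _ _ _ _
    (by rw [length_flatMap_termCode, length_termList]; simp)]
  rw [length_flatMap_termCode, length_termList]
  simp

theorem inp_node {t j : ℕ} (ht : t < D.m) (hj : j < 2 + I.toInst.bl t) :
    I.toInst.inp (I.toInst.np t + j) = (nodeCode (I.nodeList.getD t (0, []))).getD j 0 := by
  have hlen : ∀ u, (nodeCode (I.nodeList.getD u (0, []))).length = 2 + I.toInst.bl u := by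
    intro u; simp [nodeCode, toInst]; omega
  have h := getD_flatMap_append I.nodeList nodeCode (0, []) [] (t := t) (j := j)
    (by rwa [length_nodeList]) (by rwa [hlen])
  rw [← h]
  simp only [hlen]
  change I.encode.getD _ 0 = _
  rw [encode_eq, List.getD_append_right _ _ _ _ (by simp [Inst.np]; omega),
    List.getD_append_right _ _ _ _ (by
      rw [length_flatMap_termCode, length_termList]; simp [Inst.np, toInst]; omega),
    List.getD_append_right _ _ _ _ (by
      rw [length_flatMap_termCode, length_termList]; simp [Inst.np, toInst]; omega)]
  congr 1
  rw [length_flatMap_termCode, length_termList]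
  simp [Inst.np, toInst]
  omega

/-! ### The rooted tree -/

theorem parent_le (t : Fin D.m) : I.parent t ≤ t := by
  rcases Nat.eq_zero_or_pos t.val with h | h
  · exact (I.parent_root t h).le
  · exact (I.parent_lt t h).le

/-- The edges from the nonroot nodes to their parents are distinct, because parents have smaller
numbers. There are `D.m - 1` of them, which is the number of edges of a tree on `D.m` nodes, so
there are no others. -/
theorem parent_eq_of_adj {a b : Fin D.m} (h : D.tree.Adj a b) :
    I.parent b = a ∨ I.parent a = b := by
  classical
  set S : Finset (Fin D.m) := Finset.univ.filter fun t => 0 < t.val with hS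
  set f : Fin D.m → Sym2 (Fin D.m) := fun t => s(I.parent t, t) with hf
  have hinj : Set.InjOn f S := by
    intro s hs t ht hst
    have hs' := I.parent_lt s (by simpa [hS] using hs)
    have ht' := I.parent_lt t (by simpa [hS] using ht)
    simp only [hf, Sym2.eq_iff] at hst
    rcases hst with h | h
    · exact h.2
    · rw [h.1] at hs'
      rw [← h.2] at ht'
      exact absurd hs' (not_lt.mpr ht'.le)
  have hm : 0 < D.m := Fin.pos a
  have hcard : S.card + 1 = D.m := by
    have : S = Finset.univ.erase ⟨0, hm⟩ := by
      ext t
      simp [hS, Fin.ext_iff, Nat.pos_iff_ne_zero]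
    rw [this, Finset.card_erase_of_mem (Finset.mem_univ _), Finset.card_univ, Fintype.card_fin]
    omega
  have hsub : S.image f ⊆ D.tree.edgeFinset := by
    intro e he
    obtain ⟨t, ht, rfl⟩ := Finset.mem_image.mp he
    rw [SimpleGraph.mem_edgeFinset]
    exact I.parent_adj t (by simpa [hS] using ht)
  have htree := D.isTree.card_edgeFinset
  rw [Fintype.card_fin] at htree
  have heq := Finset.eq_of_subset_of_card_le hsub (by
    rw [Finset.card_image_of_injOn hinj]; omega)
  have hab : s(a, b) ∈ S.image f := by
    rw [heq, SimpleGraph.mem_edgeFinset]; exact h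
  obtain ⟨t, _, ht⟩ := Finset.mem_image.mp hab
  simp only [hf, Sym2.eq_iff] at ht
  rcases ht with ⟨h1, rfl⟩ | ⟨h1, rfl⟩
  · exact .inl h1
  · exact .inr h1

/-- If the parent's bag lacked `v`, a walk from `t` through bags containing `v` could never leave
the descendants of `t`. Connectedness would then make `u` a descendant, although descendants do not
have smaller numbers. -/
theorem mem_bag_parent {v : Fin H.n} {t u : Fin D.m} (ht : v ∈ D.bag t) (hu : v ∈ D.bag u)
    (hut : u < t) : v ∈ D.bag (I.parent t) := by
  by_contra hp
  have key : ∀ w : {w | v ∈ D.bag w},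
      Relation.ReflTransGen (D.tree.induce {w | v ∈ D.bag w}).Adj ⟨t, ht⟩ w →
      ∃ k, I.parent^[k] w.1 = t := by
    intro w hw
    induction hw with
    | refl => exact ⟨0, rfl⟩
    | @tail a b _ hab ih =>
      obtain ⟨k, hk⟩ := ih
      rcases I.parent_eq_of_adj (show D.tree.Adj a.1 b.1 from hab) with h | h
      · exact ⟨k + 1, by rw [Function.iterate_succ_apply, h, hk]⟩
      -- A step to the parent shortens the chain leading up to `t`; it is impossible only at `t`
      -- itself, where `hp` excludes it.
      · cases k with
        | zero =>
          obtain rfl : a.1 = t := hk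
          exact absurd b.2 (by rw [← h]; exact hp)
        | succ k => exact ⟨k, by rw [← h, ← Function.iterate_succ_apply, hk]⟩
  obtain ⟨k, hk⟩ := key ⟨u, hu⟩ ((SimpleGraph.reachable_iff_reflTransGen _ _).mp
    ((D.connected v).preconnected ⟨t, ht⟩ ⟨u, hu⟩))
  have hle : ∀ k, I.parent^[k] u ≤ u := by
    intro k
    induction k with
    | zero => exact le_rfl
    | succ k ih => rw [Function.iterate_succ_apply']; exact (I.parent_le _).trans ih
  exact absurd hut (not_lt.mpr (hk ▸ hle k))

/-! ### Validity of the presented instance -/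

theorem bl_eq {t : ℕ} (ht : t < D.m) : I.toInst.bl t = (I.bags ⟨t, ht⟩).length := by
  simp only [toInst, I.getD_nodeList ht, List.length_map]

theorem bg_eq {t l : ℕ} (ht : t < D.m) (hl : l < (I.bags ⟨t, ht⟩).length) :
    I.toInst.bg t l = (I.bags ⟨t, ht⟩)[l] := by
  simp only [toInst, I.getD_nodeList ht]
  simp [hl]

theorem par_eq {t : ℕ} (ht : t < D.m) : I.toInst.par t = I.parent ⟨t, ht⟩ := by
  simp only [toInst, I.getD_nodeList ht]

theorem mem_iff {t v : ℕ} (ht : t < D.m) :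
    I.toInst.Mem t v ↔ ∃ hv : v < H.n, (⟨v, hv⟩ : Fin H.n) ∈ D.bag ⟨t, ht⟩ := by
  simp only [← I.mem_bags, Inst.Mem, I.bl_eq ht]
  constructor
  · rintro ⟨l, hl, rfl⟩
    rw [I.bg_eq ht hl]
    exact ⟨Fin.isLt _, List.getElem_mem _⟩
  · rintro ⟨hv, h⟩
    obtain ⟨l, hl, h⟩ := List.getElem_of_mem h
    exact ⟨l, hl, by rw [I.bg_eq ht hl, h]⟩

theorem exists_mem {v : ℕ} (hv : v < H.n) : ∃ t, t < D.m ∧ I.toInst.Mem t v := by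
  obtain ⟨⟨t, ht⟩⟩ := (D.connected ⟨v, hv⟩).nonempty
  exact ⟨t, t.isLt, (I.mem_iff t.isLt).mpr ⟨hv, ht⟩⟩

theorem top_eq (v : ℕ) : I.toInst.top v = sInf {t | t < D.m ∧ I.toInst.Mem t v} := by
  change sInf _ = sInf _
  congr 1
  ext t
  constructor
  · rintro ⟨ht, hv, h⟩
    exact ⟨ht, (I.mem_iff ht).mpr ⟨hv, (I.mem_bags _ _).mp h⟩⟩
  · rintro ⟨ht, h⟩
    obtain ⟨hv, h⟩ := (I.mem_iff ht).mp h
    exact ⟨ht, hv, (I.mem_bags _ _).mpr h⟩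

theorem top_spec {v : ℕ} (hv : v < H.n) :
    I.toInst.top v < D.m ∧ I.toInst.Mem (I.toInst.top v) v := by
  rw [top_eq]
  exact Nat.sInf_mem (s := {t | t < D.m ∧ I.toInst.Mem t v}) (I.exists_mem hv)

theorem top_le {t v : ℕ} (ht : t < D.m) (h : I.toInst.Mem t v) : I.toInst.top v ≤ t := by
  rw [top_eq]
  exact Nat.sInf_le ⟨ht, h⟩

theorem par_mem {t v : ℕ} (ht : t < D.m) (h : I.toInst.Mem t v) (htop : I.toInst.top v < t) :
    I.toInst.Mem (I.toInst.par t) v := by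
  obtain ⟨hv, h'⟩ := (I.mem_iff ht).mp h
  obtain ⟨h1, h2⟩ := I.top_spec hv
  obtain ⟨_, h2⟩ := (I.mem_iff h1).mp h2
  rw [I.par_eq ht, I.mem_iff (Fin.isLt _)]
  exact ⟨hv, I.mem_bag_parent h' h2 htop⟩

theorem par_lt {t : ℕ} (ht : t < D.m) (h0 : 0 < t) : I.toInst.par t < t := by
  rw [I.par_eq ht]
  exact I.parent_lt ⟨t, ht⟩ h0

/-- Two variables in a common bag are both in the lower one of their topmost bags. -/
theorem mem_max_top {i j : ℕ} (t : ℕ) : t < D.m → I.toInst.Mem t i → I.toInst.Mem t j →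
    I.toInst.Mem (max (I.toInst.top i) (I.toInst.top j)) i ∧
    I.toInst.Mem (max (I.toInst.top i) (I.toInst.top j)) j := by
  induction t using Nat.strong_induction_on with
  | _ t ih =>
    intro ht hi hj
    have hle := max_le (I.top_le ht hi) (I.top_le ht hj)
    -- Below the larger of the two topmost nodes, both variables also occur higher up and therefore
    -- pass to the parent's bag.
    rcases hle.lt_or_eq with h | h
    · have hp := I.par_lt ht (by omega)
      exact ih _ hp (hp.trans ht) (I.par_mem ht hi ((le_max_left _ _).trans_lt h))
        (I.par_mem ht hj ((le_max_right _ _).trans_lt h))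
    · rw [h]; exact ⟨hi, hj⟩

theorem ti_eq {q : ℕ} (hq : q < I.terms.length) : I.toInst.ti q = (I.terms[q].1 : ℕ) := by
  simp only [toInst, I.getD_termList hq]

theorem tj_eq {q : ℕ} (hq : q < I.terms.length) : I.toInst.tj q = (I.terms[q].2 : ℕ) := by
  simp only [toInst, I.getD_termList hq]

theorem wt_eq {q : ℕ} (hq : q < I.terms.length) :
    I.toInst.wt q = H.weight I.terms[q].1 I.terms[q].2 := by
  simp only [toInst, I.getD_termList hq]

/-- For a quadratic term a common bag is given by covering, and `mem_max_top` moves it upwards. A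
linear term has the topmost node of its variable. -/
theorem node_mem {q : ℕ} (hq : q < I.terms.length) :
    I.toInst.Mem (I.toInst.node q) (I.toInst.ti q) ∧
    I.toInst.Mem (I.toInst.node q) (I.toInst.tj q) := by
  unfold Inst.node
  rw [I.ti_eq hq, I.tj_eq hq]
  have hmem : I.terms[q] ∈ H.terms := (I.mem_terms _).mp (List.getElem_mem hq)
  by_cases h : I.terms[q].1 = I.terms[q].2
  · rw [h, max_self, and_self]
    exact (I.top_spec (Fin.isLt _)).2
  · obtain ⟨t, h1, h2⟩ := D.covering I.terms[q].1 I.terms[q].2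
      ((SimpleGraph.fromRel_adj _ _ _).mpr ⟨h, .inl hmem⟩)
    exact I.mem_max_top t t.isLt ((I.mem_iff t.isLt).mpr ⟨Fin.isLt _, h1⟩)
      ((I.mem_iff t.isLt).mpr ⟨Fin.isLt _, h2⟩)

theorem valid : I.toInst.Valid where
  inp_n := by change I.encode.getD 0 0 = _; rw [encode_eq]; rfl
  inp_T := by change I.encode.getD 1 0 = _; rw [encode_eq]; rfl
  inp_ti q hq := I.inp_term hq (j := 0) (by norm_num)
  inp_tj q hq := I.inp_term hq (j := 1) (by norm_num)
  inp_wt q hq := I.inp_term hq (j := 2) (by norm_num)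
  inp_m := I.inp_m
  inp_par t ht := I.inp_node (j := 0) ht (by omega)
  inp_bl t ht := I.inp_node (j := 1) ht (by omega)
  inp_bg t ht l hl := by
    rw [add_assoc, I.inp_node (j := 2 + l) ht (by omega)]
    have hl' : l < (I.nodeList.getD t (0, [])).2.length := hl
    simp only [nodeCode]
    rw [List.getD_append_right _ _ _ _ (by simp)]
    simp only [toInst]
    rw [List.getD_eq_getElem _ _ (by simpa using hl'), List.getD_eq_getElem _ _ hl']
    simp
  bl_le t ht := by
    rw [I.bl_eq ht]
    exact (I.bags_nodup ⟨t, ht⟩).length_le_card.trans_eq (Fintype.card_fin _)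
  bg_lt t ht l hl := by
    rw [I.bl_eq ht] at hl
    rw [I.bg_eq ht hl]
    exact Fin.isLt _
  bg_inj t ht l hl l' hl' h := by
    rw [I.bl_eq ht] at hl hl'
    rw [I.bg_eq ht hl, I.bg_eq ht hl', Fin.val_inj] at h
    exact (I.bags_nodup ⟨t, ht⟩).getElem_inj_iff.mp h
  par_zero := by
    rcases Nat.eq_zero_or_pos D.m with h | h
    · have : I.nodeList = [] := List.eq_nil_of_length_eq_zero (by rw [length_nodeList, h])
      simp [toInst, this]
    · rw [I.par_eq h, I.parent_root _ rfl]
  par_lt t ht h0 := I.par_lt ht h0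
  top_lt v hv := (I.top_spec hv).1
  top_mem v hv := (I.top_spec hv).2
  top_le t ht v h := I.top_le ht h
  par_mem t ht v h h' := I.par_mem ht h h'
  ti_mem q hq := (I.node_mem hq).1
  tj_mem q hq := (I.node_mem hq).2
  ti_lt q hq := by rw [I.ti_eq hq]; exact Fin.isLt _
  tj_lt q hq := by rw [I.tj_eq hq]; exact Fin.isLt _

/-! ### Energy and size of the presented instance -/

/-- Linear terms are the diagonal pairs, which is consistent because `x_i * x_i = x_i` on binary
values. Omitted terms have weight zero. -/
theorem energy_eq (x : Fin H.n → Fin 2) (y : ℕ → Bool)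
    (h : ∀ i : Fin H.n, ((x i : ℕ) : ℤ) = (y i).toNat) : H.energy x = I.toInst.energy y := by
  classical
  set g : Fin H.n × Fin H.n → ℤ := fun p => if y p.1 && y p.2 then H.weight p.1 p.2 else 0 with hg
  have e1 : I.toInst.energy y = ∑ p ∈ H.terms, g p := by
    have : I.terms.toFinset = H.terms := by ext p; simp [I.mem_terms]
    rw [← this, List.sum_toFinset _ I.terms_nodup, ← Fin.sum_univ_fun_getElem]
    refine (Finset.sum_range _).trans (Finset.sum_congr rfl fun q _ => ?_)
    rw [I.ti_eq q.isLt, I.tj_eq q.isLt, I.wt_eq q.isLt]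
    rfl
  have e2 : ∑ p ∈ H.terms, g p = ∑ i, ∑ j, if i ≤ j then g (i, j) else 0 := by
    rw [← Fintype.sum_prod_type', Hamiltonian.terms, Finset.sum_filter]
    refine Finset.sum_congr rfl fun p _ => ?_
    by_cases h1 : p.1 ≤ p.2 <;> by_cases h2 : H.weight p.1 p.2 = 0 <;> simp [h1, h2, hg]
  rw [e1, e2, Hamiltonian.energy, ← Finset.sum_add_distrib]
  refine Finset.sum_congr rfl fun i _ => ?_
  rw [← Finset.sum_filter]
  have : Finset.univ.filter (fun j => i ≤ j) = insert i (Finset.Ioi i) := by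
    ext j; simp [le_iff_eq_or_lt]
  rw [this, Finset.sum_insert (by simp)]
  congr 1
  · rw [h]
    cases hy : y i <;> simp [hg, hy, Hamiltonian.weight]
  · refine Finset.sum_congr rfl fun j hj => ?_
    rw [h, h]
    have : i ≠ j := (Finset.mem_Ioi.mp hj).ne
    cases hy : y i <;> cases hz : y j <;> simp [hg, hy, hz, Hamiltonian.weight, this]

/-- The factor 2 pays for the one by which a bag may exceed the width. -/
theorem two_pow_bl_le {t : ℕ} (ht : t < D.m) : 2 ^ I.toInst.bl t ≤ 2 * 2 ^ D.width := by
  classical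
  rw [← pow_succ', I.bl_eq ht]
  refine Nat.pow_le_pow_right (by norm_num) ?_
  have h1 : (I.bags ⟨t, ht⟩).length = (D.bag ⟨t, ht⟩).card := by
    rw [← List.toFinset_card_of_nodup (I.bags_nodup _)]
    congr 1
    ext v
    simp [I.mem_bags]
  have h2 : (D.bag ⟨t, ht⟩).card ≤ Finset.univ.sup fun t => (D.bag t).card :=
    Finset.le_sup (f := fun t => (D.bag t).card) (Finset.mem_univ _)
  rw [h1, TreeDecomposition.width]
  omega

theorem length_terms : I.terms.length = H.terms.card := by
  classical
  rw [← List.toFinset_card_of_nodup I.terms_nodup]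
  congr 1
  ext p
  simp [I.mem_terms]

end Presentation

/-! ### From the initial machine state to the ground state -/

theorem Loop.sim_initial (l : List ℤ) :
    Sim ⟨fun _ => 0, fun _ _ => 0, fun i => l.getD i 0, fun _ => 0⟩ (RAM.initial l) where
  var _ := rfl
  arr A i := by simp [RAM.initial, adr_neg, not_le.mpr]
  raw i := by simp [RAM.initial]
  tab i := by simp [RAM.initial, adr_neg, not_le.mpr]

theorem mainTheorem3 :
    ∃ (P : RAM.Program) (C : ℕ),
      ∀ (H : Hamiltonian) (D : TreeDecomposition H.primalGraph) (I : Presentation H D),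
        ∃ (s : RAM.State) (t : ℕ),
          RAM.Runs P (RAM.initial I.encode) s t ∧
          (∃ x : Fin H.n → Fin 2, H.IsGroundState x ∧
            ∀ i : Fin H.n, s.mem ((i : ℕ) : ℤ) = ((x i : ℕ) : ℤ)) ∧
          t ≤ C * 2 ^ D.width * (H.size + D.m) ∧
          (D.width = H.tw → D.m ≤ H.size → t ≤ C * 2 ^ H.tw * H.size) := by
  obtain ⟨κ, hκ⟩ := Loop.runs_compile Loop.solve
  -- The general bound needs only 135; doubling it covers `H.size + D.m ≤ 2 * H.size` in the final
  -- claim.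
  refine ⟨Loop.compile Loop.solve 32, κ * 270, fun H D I => ?_⟩
  obtain ⟨s, t, hrun, -, hsim, ht⟩ := hκ 32 _ _ le_rfl (Loop.sim_initial I.encode)
  obtain ⟨hcost, x, hx, hmin⟩ := Loop.triple_solve (I := I.toInst)
    (s := ⟨fun _ => 0, fun _ _ => 0, fun i => I.encode.getD i 0, fun _ => 0⟩) I.valid
    (fun t ht => I.two_pow_bl_le ht) rfl (fun _ _ => rfl) (fun _ => rfl)
  -- A tree has a node, so the additive 13 in the cost can be charged to the nodes: `13 + 30 + 92 =
  -- 135`.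
  have hm : 1 ≤ D.m := by
    obtain ⟨u⟩ := D.isTree.connected.nonempty
    exact Fin.pos u
  have hB : 1 ≤ 2 ^ D.width := Nat.one_le_two_pow
  have hbound : t ≤ κ * (135 * 2 ^ D.width * (H.size + D.m)) := by
    refine ht.trans (Nat.mul_le_mul_left _ (hcost.trans ?_))
    change 13 + 4 * H.n + D.m * (30 + 46 * (2 * 2 ^ D.width)) +
      I.terms.length * (13 + 13 * (2 * 2 ^ D.width)) ≤ _
    rw [I.length_terms, Hamiltonian.size]
    generalize 2 ^ D.width = B at *
    nlinarith [Nat.mul_le_mul hm hB, Nat.mul_le_mul_left H.n hB, Nat.mul_le_mul_left D.m hB,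
      Nat.mul_le_mul_left H.terms.card hB]
  refine ⟨s, t, hrun, ⟨fun i => if x i then 1 else 0, fun y => ?_, fun i => ?_⟩, ?_, ?_⟩
  · rw [I.energy_eq _ x (fun i => by cases x i <;> simp),
      I.energy_eq y (fun v => decide (∃ hv : v < H.n, y ⟨v, hv⟩ = 1)) (fun i => ?_)]
    · exact hmin _
    · have : y i = 0 ∨ y i = 1 := by omega
      rcases this with h | h <;> simp [h]
  · rw [hsim.raw, hx _ i.isLt]
    cases hxi : x i <;> simp [hxi]
  · refine hbound.trans (le_of_le_of_eq (Nat.mul_le_mul_left κ (Nat.mul_le_mul_right _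
      (Nat.mul_le_mul_right _ (by norm_num : 135 ≤ 270)))) (by ring))
  · intro hw hsize
    rw [← hw]
    refine hbound.trans (le_of_le_of_eq (Nat.mul_le_mul_left κ (Nat.mul_le_mul_left _
      (by omega : H.size + D.m ≤ 2 * H.size))) (by ring))
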